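/- **Setting.** Let $\mathcal B$ be a (not necessarily unital) Boolean algebra, $\mathcal L$ a set, $\theta=(\theta_\alpha)_{\alpha\in\mathcal L}$ a family of Boolean homomorphisms $\theta_\alpha:\mathcal B\to\mathcal B$ with $\theta_\alpha(\emptyset)=\emptyset$, and $(\mathcal I_\alpha)_{\alpha\in\mathcal L}$ a family of ideals of $\mathcal B$ with $\{A\in\mathcal B: A\subseteq\theta_\alpha(B)\text{ for some }B\in\mathcal B\}\subseteq\mathcal I_\alpha$; that is, $(\mathcal B,\mathcal L,\theta,\mathcal I_\alpha)$ is a generalized Boolean dynamical system. Put $\Delta_B=\{\alpha\in\mathcal L:\theta_\alpha(B)\neq\emptyset\}$ and $\mathcal B_{reg}=\{A\in\mathcal B: 0<|\Delta_B|<\infty\text{ for all }\emptyset\ne B\subseteq A\}$. A *Toeplitz representation* of the system in a $C^*$-algebra consists of projections $P_A$ ($A\in\mathcal B$) and partial isometries $S_{\alpha,B}$ ($\alpha\in\mathcal L$, $B\in\mathcal I_\alpha$) such that (i) $P_\emptyset=0$, $P_{A\cap A'}=P_AP_{A'}$, $P_{A\cup A'}=P_A+P_{A'}-P_{A\cap A'}$;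 (ii) $P_AS_{\alpha,B}=S_{\alpha,B}P_{\theta_\alpha(A)}$; (iii) $S_{\alpha,B}^*S_{\alpha',B'}=\delta_{\alpha,\alpha'}P_{B\cap B'}$. It is a *Cuntz–Krieger representation* if moreover (iv) $P_A=\sum_{\alpha\in\Delta_A}S_{\alpha,\theta_\alpha(A)}S_{\alpha,\theta_\alpha(A)}^*$ for all $A\in\mathcal B_{reg}$. Let $\mathcal T(\mathcal B,\mathcal L,\theta,\mathcal I_\alpha)$ and $C^*(\mathcal B,\mathcal L,\theta,\mathcal I_\alpha)$ be the $C^*$-algebras generated by a universal Toeplitz representation and a universal Cuntz–Krieger representation $\{p_A,s_{\alpha,B}\}$, respectively. Let $\widehat{\mathcal B}$ be the space of ultrafilters of $\mathcal B$, with the topology generated by the sets $Z(A)=\{\xi: A\in\xi\}$, let $\chi_A=1_{Z(A)}\in C_0(\widehat{\mathcal B})$, and let $\mathcal A$ be the $C^*$-subalgebra of $C_0(\widehat{\mathcal B})$ generated by $\{\chi_A:A\in\mathcal B\}$. For $\alpha\in\mathcal L$ let $X_\alpha=\overline{\operatorname{span}}\{\chi_A:A\in\mathcal I_\alpha\}$,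 and let $\phi_\alpha:\mathcal A\to X_\alpha$ be the $*$-homomorphism with $\phi_\alpha(\chi_A)=\chi_{\theta_\alpha(A)}$. Let $$X=\Bigl\{(x_\alpha)\in\prod_{\alpha\in\mathcal L}X_\alpha:\ \sum_{\alpha}x_\alpha^*x_\alpha\text{ converges in }\mathcal A\Bigr\},\qquad \langle x,y\rangle=\sum_\alpha x_\alpha^*y_\alpha,\qquad (x_\alpha)\cdot f=(x_\alpha f),$$ a $C^*$-correspondence over $\mathcal A$ with left action $\phi(f)(x_\alpha)=(\phi_\alpha(f)x_\alpha)$, and for $A\in\mathcal I_\alpha$ let $e_{\alpha,A}\in X$ have $\alpha$-th coordinate $\chi_A$ and all other coordinates $0$. Let $\mathfrak K(X)$ be the closed linear span of the operators $\Theta_{x,y}:z\mapsto x\langle y,z\rangle$, and let $J_X=\phi^{-1}(\mathfrak K(X))\cap(\ker\phi)^\perp$ be Katsura's ideal. A representation of $X$ in a $C^*$-algebra is a pair $(\pi,t)$ of a $*$-homomorphism $\pi$ on $\mathcal A$ and a linear map $t$ on $X$ with $t(x)^*t(y)=\pi(\langle x,y\rangle)$ and $\pi(f)t(x)=t(\phi(f)x)$.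 It is $J_X$-coisometric if $\pi(f)=\psi_t(\phi(f))$ for all $f\in J_X$, where $\psi_t$ is the continuous linear map on $\mathfrak K(X)$ with $\psi_t(\Theta_{x,y})=t(x)t(y)^*$. The Toeplitz algebra $\mathcal T_X$ and the Cuntz–Pimsner algebra $\mathcal O_X$ are the $C^*$-algebras generated by a universal representation and by a universal $J_X$-coisometric representation $(\pi,t)$ of $X$, respectively. **Corollary.** Let $(\mathcal B,\mathcal L,\theta,\mathcal I_\alpha)$ be a generalized Boolean dynamical system, and let $X$ be its $C^*$-correspondence. Then the four universal $C^*$-algebras above exist, and 1. $\mathcal T(\mathcal B,\mathcal L,\theta,\mathcal I_\alpha)\cong\mathcal T_X$; 2. $C^*(\mathcal B,\mathcal L,\theta,\mathcal I_\alpha)\cong\mathcal O_X$; in both cases by a $*$-isomorphism that maps $p_A$ to $\pi(\chi_A)$ and $s_{\alpha,B}$ to $t(e_{\alpha,B})$. Moreover, $J_X=\overline{\operatorname{span}}\{\chi_A:A\in\mathcal B_{reg}\}$. -/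

import Mathlib

open scoped ZeroAtInfty

universe u v w

/-! ### The Stone spectrum of a (generalized) Boolean algebra and its algebra of functions -/

/-- A point of the spectrum of a generalized Boolean algebra: an ultrafilter, that is, a proper
prime filter (in a generalized Boolean algebra the maximal proper filters are exactly the proper
prime ones). -/
@[ext]
structure BoolSpectrum (𝓑 : Type*) [GeneralizedBooleanAlgebra 𝓑] where
  carrier : Set 𝓑
  nonempty : carrier.Nonempty
  bot_notMem : ⊥ ∉ carrier
  mem_of_le : ∀ {A B : 𝓑}, A ∈ carrier → A ≤ B → B ∈ carrier
  inf_mem : ∀ {A B : 𝓑}, A ∈ carrier → B ∈ carrier → A ⊓ B ∈ carrier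
  mem_or_mem : ∀ {A B : 𝓑}, A ⊔ B ∈ carrier → A ∈ carrier ∨ B ∈ carrier

namespace BoolSpectrum

variable {𝓑 : Type*} [GeneralizedBooleanAlgebra 𝓑]

/-- The basic open set `Z(A)` of all ultrafilters containing `A`. -/
def Z (A : 𝓑) : Set (BoolSpectrum 𝓑) := {ξ | A ∈ ξ.carrier}

instance : TopologicalSpace (BoolSpectrum 𝓑) :=
  TopologicalSpace.generateFrom (Set.range Z)

theorem isOpen_Z (A : 𝓑) : IsOpen (Z A) :=
  TopologicalSpace.isOpen_generateFrom_of_mem ⟨A, rfl⟩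

theorem isClosed_Z (A : 𝓑) : IsClosed (Z A) := by
  rw [← isOpen_compl_iff, isOpen_iff_forall_mem_open]
  intro ξ hξ
  obtain ⟨C, hC⟩ := ξ.nonempty
  refine ⟨Z (C \ A), ?_, isOpen_Z _, ?_⟩
  · intro η hη hA
    have := η.inf_mem hη hA
    rw [inf_comm, inf_sdiff_self_right] at this
    exact η.bot_notMem this
  · rcases ξ.mem_or_mem (A := C ⊓ A) (B := C \ A) (by rwa [sup_inf_sdiff]) with h | h
    · exact absurd (ξ.mem_of_le h inf_le_right) hξ
    · exact h

theorem isCompact_Z (A : 𝓑) : IsCompact (Z A) := by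
  refine isCompact_generateFrom rfl fun P hP hcov => ?_
  by_contra hno
  push Not at hno
  -- the order ideal generated by the members of the cover
  let I : Order.Ideal 𝓑 := Order.IsIdeal.toIdeal
    (I := {b | ∃ s : Finset 𝓑, (∀ c ∈ s, Z c ∈ P) ∧ b ≤ s.sup id})
    { IsLowerSet := fun a b hab ⟨s, hs, h⟩ => ⟨s, hs, hab.trans h⟩
      Nonempty := ⟨⊥, ∅, by simp, bot_le⟩
      Directed := by
        classical
        rintro a ⟨s, hs, ha⟩ b ⟨t, ht, hb⟩
        refine ⟨a ⊔ b, ⟨s ∪ t, ?_, ?_⟩, le_sup_left, le_sup_right⟩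
        · intro c hc
          rcases Finset.mem_union.1 hc with h | h
          exacts [hs c h, ht c h]
        · rw [Finset.sup_union]
          exact sup_le_sup ha hb }
  have hdisj : Disjoint ((Order.PFilter.principal A : Order.PFilter 𝓑) : Set 𝓑) (I : Set 𝓑) := by
    rw [Set.disjoint_left]
    rintro b hb ⟨s, hs, hbs⟩
    have hAs : A ≤ s.sup id := (show A ≤ b from hb).trans hbs
    refine hno (Z '' (s : Set 𝓑)) ?_ (s.finite_toSet.image _) ?_
    · rintro _ ⟨c, hc, rfl⟩
      exact hs c hc
    · intro ξ hξ
      have key : ∀ t : Finset 𝓑, t.sup id ∈ ξ.carrier → ∃ c ∈ t, c ∈ ξ.carrier := by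
        classical
        intro t
        induction t using Finset.induction_on with
        | empty => intro h; exact absurd h ξ.bot_notMem
        | insert a t _ ih =>
          intro h
          rw [Finset.sup_insert] at h
          rcases ξ.mem_or_mem h with h | h
          · exact ⟨a, by simp, h⟩
          · obtain ⟨c, hc, hcξ⟩ := ih h
            exact ⟨c, Finset.mem_insert_of_mem hc, hcξ⟩
      obtain ⟨c, hc, hcξ⟩ := key s (ξ.mem_of_le hξ hAs)
      exact ⟨Z c, ⟨c, hc, rfl⟩, hcξ⟩
  obtain ⟨J, hJ, hIJ, hFJ⟩ := DistribLattice.prime_ideal_of_disjoint_filter_ideal hdisj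
  have hAJ : A ∉ J := Set.disjoint_left.1 hFJ (show A ≤ A from le_rfl)
  let ξ : BoolSpectrum 𝓑 :=
    { carrier := {b | b ∉ J}
      nonempty := ⟨A, hAJ⟩
      bot_notMem := fun h => h J.bot_mem
      mem_of_le := fun ha hab hb => ha (J.lower hab hb)
      inf_mem := fun ha hb hab => (hJ.mem_or_mem hab).elim ha hb
      mem_or_mem := fun {a b} h => by
        by_contra hcon
        push Not at hcon
        exact h (Order.Ideal.sup_mem (not_not.1 hcon.1) (not_not.1 hcon.2)) }
  obtain ⟨U, hU, hξU⟩ := hcov (show ξ ∈ Z A from hAJ)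
  obtain ⟨c, rfl⟩ := hP hU
  exact hξU (hIJ ⟨{c}, by simpa using hU, by simp⟩)

end BoolSpectrum

/-- The function `χ_A = 1_{Z(A)} ∈ C₀(spectrum)`. -/
noncomputable def chiFun {𝓑 : Type*} [GeneralizedBooleanAlgebra 𝓑] (A : 𝓑) :
    C₀(BoolSpectrum 𝓑, ℂ) where
  toFun := (BoolSpectrum.Z A).indicator (fun _ => 1)
  continuous_toFun := by
    have h : IsClopen (BoolSpectrum.Z A) := ⟨BoolSpectrum.isClosed_Z A, BoolSpectrum.isOpen_Z A⟩
    exact continuous_const.indicator (by simp [h.frontier_eq])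
  zero_at_infty' := by
    refine Filter.Tendsto.congr' ?_ tendsto_const_nhds
    filter_upwards [(BoolSpectrum.isCompact_Z A).compl_mem_cocompact] with ξ hξ
    simp only [Set.mem_compl_iff] at hξ
    simp [hξ]

/-- The `C*`-subalgebra of `C₀(spectrum)` generated by the functions `χ_A`. -/
noncomputable def functionSubalgebra (𝓑 : Type*) [GeneralizedBooleanAlgebra 𝓑] :
    NonUnitalStarSubalgebra ℂ C₀(BoolSpectrum 𝓑, ℂ) :=
  (NonUnitalStarAlgebra.adjoin ℂ (Set.range (chiFun (𝓑 := 𝓑)))).topologicalClosure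

/-- The commutative `C*`-algebra `𝒜(𝓑)` generated by the functions `χ_A`. -/
def FunctionAlg (𝓑 : Type*) [GeneralizedBooleanAlgebra 𝓑] : Type _ := functionSubalgebra 𝓑

namespace FunctionAlg

variable {𝓑 : Type*} [GeneralizedBooleanAlgebra 𝓑]

instance isClosed_functionSubalgebra :
    IsClosed (functionSubalgebra 𝓑 : Set C₀(BoolSpectrum 𝓑, ℂ)) :=
  NonUnitalStarSubalgebra.isClosed_topologicalClosure _

noncomputable instance : NonUnitalCommCStarAlgebra (FunctionAlg 𝓑) :=
  inferInstanceAs (NonUnitalCommCStarAlgebra (functionSubalgebra 𝓑))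

/-- The usual order of a `C*`-algebra. -/
noncomputable instance : PartialOrder (FunctionAlg 𝓑) := CStarAlgebra.spectralOrder _

instance : StarOrderedRing (FunctionAlg 𝓑) := CStarAlgebra.spectralOrderedRing _

/-- The inclusion of `𝒜(𝓑)` into `C₀(spectrum)`. -/
noncomputable def toC₀ : FunctionAlg 𝓑 →⋆ₙₐ[ℂ] C₀(BoolSpectrum 𝓑, ℂ) :=
  NonUnitalStarSubalgebraClass.subtype (functionSubalgebra 𝓑)

/-- Evaluation at a point of the spectrum. -/
noncomputable def eval (ξ : BoolSpectrum 𝓑) : FunctionAlg 𝓑 →⋆ₙₐ[ℂ] ℂ where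
  toFun f := toC₀ f ξ
  map_smul' c f := by simp
  map_zero' := by simp
  map_add' f g := by simp
  map_mul' f g := by simp
  map_star' f := by rw [map_star]; rfl

/-- The element `χ_A` of `𝒜(𝓑)`. -/
noncomputable def chi (A : 𝓑) : FunctionAlg 𝓑 :=
  (⟨chiFun A, NonUnitalStarSubalgebra.le_topologicalClosure _
    (NonUnitalStarAlgebra.subset_adjoin ℂ _ ⟨A, rfl⟩)⟩ : functionSubalgebra 𝓑)

theorem ext_eval {f g : FunctionAlg 𝓑} (h : ∀ ξ, eval ξ f = eval ξ g) : f = g :=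
  Subtype.ext (DFunLike.ext _ _ h)

theorem norm_eval_le (ξ : BoolSpectrum 𝓑) (f : FunctionAlg 𝓑) : ‖eval ξ f‖ ≤ ‖f‖ :=
  (toC₀ f).toBCF.norm_coe_le_norm ξ

theorem norm_le {f : FunctionAlg 𝓑} {c : ℝ} (hc : 0 ≤ c) (h : ∀ ξ, ‖eval ξ f‖ ≤ c) : ‖f‖ ≤ c :=
  (BoundedContinuousFunction.norm_le (f := (toC₀ f).toBCF) hc).2 h

theorem continuous_eval (ξ : BoolSpectrum 𝓑) : Continuous (eval ξ : FunctionAlg 𝓑 → ℂ) :=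
  AddMonoidHomClass.continuous_of_bound (eval ξ) 1 fun f => by simpa using norm_eval_le ξ f

open Classical in
theorem eval_chi (ξ : BoolSpectrum 𝓑) (A : 𝓑) :
    eval ξ (chi A) = if A ∈ ξ.carrier then 1 else 0 := by
  change (BoolSpectrum.Z A).indicator (fun _ => (1 : ℂ)) ξ = _
  simp [Set.indicator_apply, BoolSpectrum.Z]

theorem chi_mul_chi (A B : 𝓑) : chi A * chi B = chi (A ⊓ B) := by
  classical
  refine ext_eval fun ξ => ?_
  rw [map_mul, eval_chi, eval_chi, eval_chi]
  have : A ⊓ B ∈ ξ.carrier ↔ A ∈ ξ.carrier ∧ B ∈ ξ.carrier :=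
    ⟨fun h => ⟨ξ.mem_of_le h inf_le_left, ξ.mem_of_le h inf_le_right⟩, fun h => ξ.inf_mem h.1 h.2⟩
  by_cases hA : A ∈ ξ.carrier <;> by_cases hB : B ∈ ξ.carrier <;> simp [hA, hB, this]

theorem star_chi (A : 𝓑) : star (chi A) = chi A := by
  classical
  refine ext_eval fun ξ => ?_
  rw [map_star, eval_chi]
  split_ifs <;> simp

theorem mul_mem_span_chi {f g : FunctionAlg 𝓑} (hf : f ∈ Submodule.span ℂ (Set.range (chi (𝓑 := 𝓑))))
    (hg : g ∈ Submodule.span ℂ (Set.range (chi (𝓑 := 𝓑)))) :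
    f * g ∈ Submodule.span ℂ (Set.range (chi (𝓑 := 𝓑))) := by
  induction hf using Submodule.span_induction with
  | mem _ h =>
    obtain ⟨A, rfl⟩ := h
    induction hg using Submodule.span_induction with
    | mem _ h =>
      obtain ⟨B, rfl⟩ := h
      exact Submodule.subset_span ⟨A ⊓ B, (chi_mul_chi A B).symm⟩
    | zero => simp
    | add x y _ _ hx hy => rw [mul_add]; exact add_mem hx hy
    | smul c x _ hx => rw [mul_smul_comm]; exact Submodule.smul_mem _ c hx
  | zero => simp
  | add x y _ _ hx hy => rw [add_mul]; exact add_mem hx hy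
  | smul c x _ hx => rw [smul_mul_assoc]; exact Submodule.smul_mem _ c hx

theorem star_mem_span_chi {f : FunctionAlg 𝓑} (hf : f ∈ Submodule.span ℂ (Set.range (chi (𝓑 := 𝓑)))) :
    star f ∈ Submodule.span ℂ (Set.range (chi (𝓑 := 𝓑))) := by
  induction hf using Submodule.span_induction with
  | mem _ h =>
    obtain ⟨A, rfl⟩ := h
    exact Submodule.subset_span ⟨A, (star_chi A).symm⟩
  | zero => simp
  | add x y _ _ hx hy => rw [star_add]; exact add_mem hx hy
  | smul c x _ hx => rw [star_smul]; exact Submodule.smul_mem _ _ hx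

/-- `𝒜(𝓑)` is the closed linear span of the functions `χ_A`. -/
theorem mem_closure_span_chi (f : FunctionAlg 𝓑) :
    f ∈ closure (Submodule.span ℂ (Set.range (chi (𝓑 := 𝓑))) : Set (FunctionAlg 𝓑)) := by
  have hind : Topology.IsInducing (toC₀ (𝓑 := 𝓑)) := Topology.IsInducing.subtypeVal
  rw [hind.closure_eq_preimage_closure_image]
  refine closure_mono ?_ (show toC₀ f ∈ _ from (show functionSubalgebra 𝓑 from f).2)
  intro g hg
  induction hg using NonUnitalStarAlgebra.adjoin_induction with
  | mem x h =>
    obtain ⟨A, rfl⟩ := h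
    exact ⟨chi A, Submodule.subset_span ⟨A, rfl⟩, rfl⟩
  | zero => exact ⟨0, zero_mem _, map_zero _⟩
  | add x y _ _ hx hy =>
    obtain ⟨a, ha, rfl⟩ := hx
    obtain ⟨b, hb, rfl⟩ := hy
    exact ⟨a + b, add_mem ha hb, map_add _ _ _⟩
  | mul x y _ _ hx hy =>
    obtain ⟨a, ha, rfl⟩ := hx
    obtain ⟨b, hb, rfl⟩ := hy
    exact ⟨a * b, mul_mem_span_chi ha hb, map_mul _ _ _⟩
  | smul c x _ hx =>
    obtain ⟨a, ha, rfl⟩ := hx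
    exact ⟨c • a, Submodule.smul_mem _ c ha, map_smul _ _ _⟩
  | star x _ hx =>
    obtain ⟨a, ha, rfl⟩ := hx
    exact ⟨star a, star_mem_span_chi ha, map_star _ _⟩

/-- The closed linear span of `{χ_A : A ∈ S}`; for an ideal `S` of `𝓑` this is the closed ideal
of `𝒜(𝓑)` generated by `{χ_A : A ∈ S}`. -/
noncomputable def chiSpan (S : Set 𝓑) : Submodule ℂ (FunctionAlg 𝓑) :=
  (Submodule.span ℂ (chi '' S)).topologicalClosure

theorem chi_mem_chiSpan {S : Set 𝓑} {A : 𝓑} (hA : A ∈ S) : chi A ∈ chiSpan S :=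
  Submodule.le_topologicalClosure _ (Submodule.subset_span ⟨A, hA, rfl⟩)

theorem isClosed_chiSpan (S : Set 𝓑) : IsClosed (chiSpan S : Set (FunctionAlg 𝓑)) :=
  Submodule.isClosed_topologicalClosure _

theorem mul_mem_chiSpan (I : Order.Ideal 𝓑) (f : FunctionAlg 𝓑) {g : FunctionAlg 𝓑}
    (hg : g ∈ chiSpan (I : Set 𝓑)) : f * g ∈ chiSpan (I : Set 𝓑) := by
  -- reduce to `f = χ_A`, then to `g = χ_B`
  have key : ∀ (A : 𝓑) (g : FunctionAlg 𝓑), g ∈ chiSpan (I : Set 𝓑) →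
      chi A * g ∈ chiSpan (I : Set 𝓑) := by
    intro A g hg
    have hcl : IsClosed {g : FunctionAlg 𝓑 | chi A * g ∈ chiSpan (I : Set 𝓑)} :=
      (isClosed_chiSpan _).preimage (continuous_const.mul continuous_id)
    refine closure_minimal (fun g hg => ?_) hcl hg
    rw [Set.mem_ofPred_eq]
    induction hg using Submodule.span_induction with
    | mem _ h =>
      obtain ⟨B, hB, rfl⟩ := h
      rw [chi_mul_chi]
      exact chi_mem_chiSpan (I.lower inf_le_right hB)
    | zero => simp
    | add x y _ _ hx hy => rw [mul_add]; exact add_mem hx hy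
    | smul c x _ hx => rw [mul_smul_comm]; exact Submodule.smul_mem _ c hx
  have hcl : IsClosed {f : FunctionAlg 𝓑 | f * g ∈ chiSpan (I : Set 𝓑)} :=
    (isClosed_chiSpan _).preimage (continuous_id.mul continuous_const)
  refine closure_minimal (fun f hf => ?_) hcl (mem_closure_span_chi f)
  rw [Set.mem_ofPred_eq]
  induction hf using Submodule.span_induction with
  | mem _ h =>
    obtain ⟨A, rfl⟩ := h
    exact key A g hg
  | zero => simp
  | add x y _ _ hx hy => rw [add_mul]; exact add_mem hx hy
  | smul c x _ hx => rw [smul_mul_assoc]; exact Submodule.smul_mem _ c hx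

end FunctionAlg
/-! ### Generalized Boolean dynamical systems -/

/-- An action on a Boolean algebra: a Boolean homomorphism to itself that fixes `∅`. -/
structure IsBoolAction {𝓑 : Type*} [GeneralizedBooleanAlgebra 𝓑] (θ : 𝓑 → 𝓑) : Prop where
  map_inf : ∀ A B, θ (A ⊓ B) = θ A ⊓ θ B
  map_sup : ∀ A B, θ (A ⊔ B) = θ A ⊔ θ B
  map_sdiff : ∀ A B, θ (A \ B) = θ A \ θ B
  map_bot : θ ⊥ = ⊥

theorem IsBoolAction.mono {𝓑 : Type*} [GeneralizedBooleanAlgebra 𝓑] {θ : 𝓑 → 𝓑}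
    (hθ : IsBoolAction θ) {A B : 𝓑} (h : A ≤ B) : θ A ≤ θ B := by
  rw [← inf_eq_left, ← hθ.map_inf, inf_eq_left.2 h]

/-- A generalized Boolean dynamical system: a family of actions `θ α` on `𝓑` indexed by `𝓛`, and a
family of ideals `I α` of `𝓑`, each containing `R_α = {A | A ⊆ θ_α(B) for some B}`. -/
structure GenBoolDynSystem (𝓑 𝓛 : Type*) [GeneralizedBooleanAlgebra 𝓑] where
  θ : 𝓛 → 𝓑 → 𝓑
  isBoolAction : ∀ α, IsBoolAction (θ α)
  I : 𝓛 → Order.Ideal 𝓑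
  range_subset : ∀ α, {A : 𝓑 | ∃ B, A ≤ θ α B} ⊆ (I α : Set 𝓑)

/-! ### The homomorphism of function algebras induced by an action -/

namespace FunctionAlg

variable {𝓑 : Type*} [GeneralizedBooleanAlgebra 𝓑]

/-- The preimage of an ultrafilter under an action, if it is non-empty. -/
def comapPoint {θ : 𝓑 → 𝓑} (hθ : IsBoolAction θ) (ξ : BoolSpectrum 𝓑)
    (h : ∃ A, θ A ∈ ξ.carrier) : BoolSpectrum 𝓑 where
  carrier := {A | θ A ∈ ξ.carrier}
  nonempty := h
  bot_notMem := fun hb => ξ.bot_notMem (by rwa [Set.mem_ofPred_eq, hθ.map_bot] at hb)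
  mem_of_le := fun hA hAB => ξ.mem_of_le hA (hθ.mono hAB)
  inf_mem := fun hA hB => by
    rw [Set.mem_ofPred_eq, hθ.map_inf]; exact ξ.inf_mem hA hB
  mem_or_mem := fun hAB => by
    rw [Set.mem_ofPred_eq, hθ.map_sup] at hAB; exact ξ.mem_or_mem hAB

open Classical in
/-- Evaluation at the preimage of `ξ` under `θ`, and zero if this preimage is empty. -/
noncomputable def pullEval {θ : 𝓑 → 𝓑} (hθ : IsBoolAction θ) (ξ : BoolSpectrum 𝓑) :
    FunctionAlg 𝓑 →⋆ₙₐ[ℂ] ℂ :=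
  if h : ∃ A, θ A ∈ ξ.carrier then eval (comapPoint hθ ξ h) else 0

theorem norm_pullEval_le {θ : 𝓑 → 𝓑} (hθ : IsBoolAction θ) (ξ : BoolSpectrum 𝓑)
    (f : FunctionAlg 𝓑) : ‖pullEval hθ ξ f‖ ≤ ‖f‖ := by
  unfold pullEval
  split_ifs
  · exact norm_eval_le _ f
  · simp

theorem pullEval_chi {θ : 𝓑 → 𝓑} (hθ : IsBoolAction θ) (ξ : BoolSpectrum 𝓑) (A : 𝓑) :
    pullEval hθ ξ (chi A) = eval ξ (chi (θ A)) := by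
  classical
  rw [eval_chi]
  unfold pullEval
  split_ifs with h hA hA
  · rw [eval_chi, if_pos (show A ∈ (comapPoint hθ ξ h).carrier from hA)]
  · rw [eval_chi, if_neg (show A ∉ (comapPoint hθ ξ h).carrier from hA)]
  · exact absurd ⟨A, hA⟩ h
  · rfl

theorem exists_pull {θ : 𝓑 → 𝓑} (hθ : IsBoolAction θ) (f : FunctionAlg 𝓑) :
    ∃ g : FunctionAlg 𝓑, ∀ ξ, eval ξ g = pullEval hθ ξ f := by
  have hspan : ∀ f ∈ Submodule.span ℂ (Set.range (chi (𝓑 := 𝓑))),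
      ∃ g : FunctionAlg 𝓑, ∀ ξ, eval ξ g = pullEval hθ ξ f := by
    intro f hf
    induction hf using Submodule.span_induction with
    | mem _ h =>
      obtain ⟨A, rfl⟩ := h
      exact ⟨chi (θ A), fun ξ => (pullEval_chi hθ ξ A).symm⟩
    | zero => exact ⟨0, fun ξ => by simp⟩
    | add x y _ _ hx hy =>
      obtain ⟨a, ha⟩ := hx
      obtain ⟨b, hb⟩ := hy
      exact ⟨a + b, fun ξ => by simp [ha, hb]⟩
    | smul c x _ hx =>
      obtain ⟨a, ha⟩ := hx
      exact ⟨c • a, fun ξ => by simp [ha]⟩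
  obtain ⟨u, hu, hlim⟩ := mem_closure_iff_seq_limit.1 (mem_closure_span_chi f)
  choose g hg using fun n => hspan (u n) (hu n)
  have hdist : ∀ m n, dist (g m) (g n) ≤ dist (u m) (u n) := by
    intro m n
    rw [dist_eq_norm, dist_eq_norm]
    refine norm_le (norm_nonneg _) fun ξ => ?_
    rw [map_sub, hg, hg, ← map_sub]
    exact norm_pullEval_le hθ ξ _
  have hcau : CauchySeq g := by
    rw [Metric.cauchySeq_iff]
    intro ε hε
    obtain ⟨N, hN⟩ := Metric.cauchySeq_iff.1 hlim.cauchySeq ε hε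
    exact ⟨N, fun m hm n hn => (hdist m n).trans_lt (hN m hm n hn)⟩
  obtain ⟨l, hl⟩ := cauchySeq_tendsto_of_complete hcau
  refine ⟨l, fun ξ => ?_⟩
  have h1 := ((continuous_eval ξ).tendsto l).comp hl
  have hc : Continuous (pullEval hθ ξ : FunctionAlg 𝓑 → ℂ) :=
    AddMonoidHomClass.continuous_of_bound (pullEval hθ ξ) 1 fun f => by
      simpa using norm_pullEval_le hθ ξ f
  have h2 := (hc.tendsto f).comp hlim
  refine tendsto_nhds_unique h1 (h2.congr fun n => ?_)
  simp [hg]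

/-- The function underlying `pull`. -/
noncomputable def pullFun {θ : 𝓑 → 𝓑} (hθ : IsBoolAction θ) (f : FunctionAlg 𝓑) : FunctionAlg 𝓑 :=
  (exists_pull hθ f).choose

theorem eval_pullFun {θ : 𝓑 → 𝓑} (hθ : IsBoolAction θ) (f : FunctionAlg 𝓑)
    (ξ : BoolSpectrum 𝓑) : eval ξ (pullFun hθ f) = pullEval hθ ξ f :=
  (exists_pull hθ f).choose_spec ξ

/-- The `*`-homomorphism `𝒜(𝓑) → 𝒜(𝓑)` induced by an action `θ`; it is the unique
`*`-homomorphism that maps `χ_A` to `χ_{θ(A)}`, see `pull_chi`. -/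
noncomputable def pull {θ : 𝓑 → 𝓑} (hθ : IsBoolAction θ) : FunctionAlg 𝓑 →⋆ₙₐ[ℂ] FunctionAlg 𝓑 where
  toFun := pullFun hθ
  map_smul' c f := ext_eval fun ξ => by simp [eval_pullFun]
  map_zero' := ext_eval fun ξ => by simp [eval_pullFun]
  map_add' f g := ext_eval fun ξ => by simp [eval_pullFun]
  map_mul' f g := ext_eval fun ξ => by simp [eval_pullFun]
  map_star' f := ext_eval fun ξ => by simp only [map_star, eval_pullFun]

theorem eval_pull {θ : 𝓑 → 𝓑} (hθ : IsBoolAction θ) (f : FunctionAlg 𝓑) (ξ : BoolSpectrum 𝓑) :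
    eval ξ (pull hθ f) = pullEval hθ ξ f :=
  eval_pullFun hθ f ξ

/-- `φ_θ(χ_A) = χ_{θ(A)}`. -/
theorem pull_chi {θ : 𝓑 → 𝓑} (hθ : IsBoolAction θ) (A : 𝓑) : pull hθ (chi A) = chi (θ A) :=
  ext_eval fun ξ => by rw [eval_pull, pullEval_chi]

theorem norm_pull_le {θ : 𝓑 → 𝓑} (hθ : IsBoolAction θ) (f : FunctionAlg 𝓑) :
    ‖pull hθ f‖ ≤ ‖f‖ :=
  norm_le (norm_nonneg _) fun ξ => by rw [eval_pull]; exact norm_pullEval_le hθ ξ f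

end FunctionAlg
/-! ### The Hilbert module `X = ⨁ X_α` -/

namespace FunctionAlg

variable {𝓑 𝓛 : Type*} [GeneralizedBooleanAlgebra 𝓑]

theorem sum_sq_eval_le (x : 𝓛 → FunctionAlg 𝓑) (F : Finset 𝓛) (ξ : BoolSpectrum 𝓑) :
    ∑ α ∈ F, ‖eval ξ (x α)‖ ^ 2 ≤ ‖∑ α ∈ F, star (x α) * x α‖ := by
  refine le_trans (le_of_eq ?_) (norm_eval_le ξ _)
  have : eval ξ (∑ α ∈ F, star (x α) * x α) = ((∑ α ∈ F, ‖eval ξ (x α)‖ ^ 2 : ℝ) : ℂ) := by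
    rw [map_sum, Complex.ofReal_sum]
    refine Finset.sum_congr rfl fun α _ => ?_
    rw [map_mul, map_star]
    simpa using Complex.conj_mul' (eval ξ (x α))
  rw [this, Complex.norm_real, Real.norm_of_nonneg (Finset.sum_nonneg fun _ _ => sq_nonneg _)]

theorem summable_of_norm_sum_le {h p q : 𝓛 → FunctionAlg 𝓑} (C : ℝ) (hp : Summable p)
    (hq : Summable q)
    (hle : ∀ F : Finset 𝓛, ‖∑ α ∈ F, h α‖ ≤ C * (‖∑ α ∈ F, p α‖ + ‖∑ α ∈ F, q α‖)) :
    Summable h := by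
  classical
  rw [summable_iff_vanishing_norm] at hp hq ⊢
  intro ε hε
  have hδ : 0 < ε / (2 * (|C| + 1)) := by positivity
  obtain ⟨s, hs⟩ := hp _ hδ
  obtain ⟨t, ht⟩ := hq _ hδ
  refine ⟨s ∪ t, fun F hF => ?_⟩
  rw [Finset.disjoint_union_right] at hF
  have h1 := hs F hF.1
  have h2 := ht F hF.2
  calc ‖∑ α ∈ F, h α‖ ≤ C * (‖∑ α ∈ F, p α‖ + ‖∑ α ∈ F, q α‖) := hle F
    _ ≤ (|C| + 1) * (‖∑ α ∈ F, p α‖ + ‖∑ α ∈ F, q α‖) := by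
      gcongr; linarith [le_abs_self C]
    _ < (|C| + 1) * (ε / (2 * (|C| + 1)) + ε / (2 * (|C| + 1))) := by gcongr
    _ = ε := by field_simp; ring

theorem summable_star_mul {x y : 𝓛 → FunctionAlg 𝓑} (hx : Summable fun α => star (x α) * x α)
    (hy : Summable fun α => star (y α) * y α) : Summable fun α => star (x α) * y α := by
  refine summable_of_norm_sum_le 1 hx hy fun F => norm_le (by positivity) fun ξ => ?_
  rw [one_mul]
  refine le_trans ?_ (add_le_add (sum_sq_eval_le x F ξ) (sum_sq_eval_le y F ξ))
  rw [map_sum, ← Finset.sum_add_distrib]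
  refine (norm_sum_le _ _).trans (Finset.sum_le_sum fun α _ => ?_)
  rw [map_mul, map_star, norm_mul, norm_star]
  nlinarith [sq_nonneg (‖eval ξ (x α)‖ - ‖eval ξ (y α)‖), sq_nonneg ‖eval ξ (x α)‖,
    sq_nonneg ‖eval ξ (y α)‖]

end FunctionAlg

namespace GenBoolDynSystem

open FunctionAlg

variable {𝓑 𝓛 : Type*} [GeneralizedBooleanAlgebra 𝓑] (D : GenBoolDynSystem 𝓑 𝓛)

/-- The families `(x_α)` in `∏ X_α` for which `∑ x_α^* x_α` converges; here `X_α` is the ideal of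
`𝒜(𝓑)` generated by `{χ_A : A ∈ I_α}`. -/
def moduleCarrier : Submodule ℂ (𝓛 → FunctionAlg 𝓑) where
  carrier := {x | (∀ α, x α ∈ chiSpan (D.I α : Set 𝓑)) ∧ Summable fun α => star (x α) * x α}
  zero_mem' := ⟨fun α => zero_mem _, by simp [summable_zero]⟩
  add_mem' := fun {x y} hx hy => ⟨fun α => add_mem (hx.1 α) (hy.1 α), by
    have := ((hx.2.add (summable_star_mul hx.2 hy.2)).add (summable_star_mul hy.2 hx.2)).add hy.2
    refine this.congr fun α => ?_
    simp only [Pi.add_apply, star_add, add_mul, mul_add]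
    abel⟩
  smul_mem' := fun c x hx => ⟨fun α => Submodule.smul_mem _ c (hx.1 α), by
    refine (hx.2.const_smul (star c * c)).congr fun α => ?_
    simp only [Pi.smul_apply, star_smul, smul_mul_smul_comm]⟩

/-- The Hilbert `𝒜(𝓑)`-module `X(𝓑, 𝓛, θ, I) = ⨁ X_α`. -/
def HilbertMod : Type _ := D.moduleCarrier

namespace HilbertMod

variable {D}

noncomputable instance : AddCommGroup D.HilbertMod := inferInstanceAs (AddCommGroup D.moduleCarrier)

noncomputable instance : Module ℂ D.HilbertMod := inferInstanceAs (Module ℂ D.moduleCarrier)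

/-- The `α`-th coordinate of an element of `X`. -/
def coord (x : D.HilbertMod) (α : 𝓛) : FunctionAlg 𝓑 := Subtype.val (p := (· ∈ D.moduleCarrier)) x α

theorem coord_mem (x : D.HilbertMod) (α : 𝓛) : x.coord α ∈ chiSpan (D.I α : Set 𝓑) := x.2.1 α

theorem summable_coord (x y : D.HilbertMod) :
    Summable fun α => star (x.coord α) * y.coord α := summable_star_mul x.2.2 y.2.2

theorem ext_coord {x y : D.HilbertMod} (h : ∀ α, x.coord α = y.coord α) : x = y :=
  Subtype.ext (funext h)

@[simp] theorem coord_add (x y : D.HilbertMod) (α : 𝓛) :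
    (x + y).coord α = x.coord α + y.coord α := rfl

@[simp] theorem coord_zero (α : 𝓛) : (0 : D.HilbertMod).coord α = 0 := rfl

@[simp] theorem coord_smul (c : ℂ) (x : D.HilbertMod) (α : 𝓛) :
    (c • x).coord α = c • x.coord α := rfl

/-- The right action `(x_α) · f = (x_α f)` of `𝒜(𝓑)`, written `f • x`. -/
noncomputable instance : SMul (FunctionAlg 𝓑) D.HilbertMod where
  smul f x := (⟨fun α => x.coord α * f, fun α => by
      simpa only [mul_comm] using mul_mem_chiSpan _ f (x.coord_mem α), by
      refine ((x.summable_coord x).mul_left (star f * f)).congr fun α => ?_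
      rw [star_mul]; simp only [mul_assoc, mul_comm, mul_left_comm]⟩ : D.moduleCarrier)

@[simp] theorem coord_action (f : FunctionAlg 𝓑) (x : D.HilbertMod) (α : 𝓛) :
    (f • x).coord α = x.coord α * f := rfl

/-- The inner product `⟨x, y⟩ = ∑ x_α^* y_α`. -/
noncomputable instance : Inner (FunctionAlg 𝓑) D.HilbertMod where
  inner x y := ∑' α, star (x.coord α) * y.coord α

theorem inner_def (x y : D.HilbertMod) :
    inner (FunctionAlg 𝓑) x y = ∑' α, star (x.coord α) * y.coord α := rfl

/-- The norm `‖x‖ = ‖⟨x, x⟩‖^{1/2}`. -/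
noncomputable instance : Norm D.HilbertMod := CStarModule.norm (FunctionAlg 𝓑)

theorem hasSum_eval_inner (x y : D.HilbertMod) (ξ : BoolSpectrum 𝓑) :
    HasSum (fun α => star (eval ξ (x.coord α)) * eval ξ (y.coord α))
      (eval ξ (inner (FunctionAlg 𝓑) x y)) := by
  have := (x.summable_coord y).hasSum.map (eval ξ) (continuous_eval ξ)
  rw [inner_def]
  simpa only [Function.comp_def, map_mul, map_star] using this

theorem hasSum_eval_inner_self (x : D.HilbertMod) (ξ : BoolSpectrum 𝓑) :
    HasSum (fun α => ‖eval ξ (x.coord α)‖ ^ 2) ‖eval ξ (inner (FunctionAlg 𝓑) x x)‖ := by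
  have h := x.hasSum_eval_inner x ξ
  have h' : ∀ α, star (eval ξ (x.coord α)) * eval ξ (x.coord α) =
      ((‖eval ξ (x.coord α)‖ ^ 2 : ℝ) : ℂ) := fun α => by
    simpa using Complex.conj_mul' (eval ξ (x.coord α))
  simp only [h'] at h
  have hs : Summable fun α => ‖eval ξ (x.coord α)‖ ^ 2 := by
    exact (Complex.hasSum_re h).summable.congr fun α => (Complex.ofReal_re _)
  have heq := (hs.hasSum.mapL Complex.ofRealCLM).unique h
  rw [← heq]
  simpa [Complex.norm_real, abs_of_nonneg (tsum_nonneg fun α => sq_nonneg ‖eval ξ (x.coord α)‖)]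
    using hs.hasSum

noncomputable instance : CStarModule (FunctionAlg 𝓑) D.HilbertMod where
  inner_add_right {x y z} := by
    rw [inner_def, inner_def, inner_def, ← (x.summable_coord y).tsum_add (x.summable_coord z)]
    simp only [coord_add, mul_add]
  inner_self_nonneg {x} := tsum_nonneg fun α => star_mul_self_nonneg _
  inner_self {x} := by
    refine ⟨fun h => ext_coord fun α => ext_eval fun ξ => ?_, ?_⟩
    · have hs := x.hasSum_eval_inner_self ξ
      rw [h, map_zero, norm_zero, hasSum_zero_iff_of_nonneg (fun α => sq_nonneg _)] at hs
      simpa using congrFun hs α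
    · rintro rfl
      simp [inner_def]
  inner_op_smul_right {a x y} := by
    rw [inner_def, inner_def, ← (x.summable_coord y).tsum_mul_left]
    exact tsum_congr fun α => by rw [coord_action, mul_comm a, mul_assoc]
  inner_smul_right_complex {z x y} := by
    rw [inner_def, inner_def, ← (x.summable_coord y).tsum_const_smul]
    simp only [coord_smul, mul_smul_comm]
  star_inner x y := by
    rw [inner_def, inner_def, tsum_star]
    simp only [star_mul, star_star]
  norm_eq_sqrt_norm_inner_self x := rfl

noncomputable instance : NormedAddCommGroup D.HilbertMod :=
  NormedAddCommGroup.ofCore (CStarModule.normedSpaceCore (FunctionAlg 𝓑))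

noncomputable instance : NormedSpace ℂ D.HilbertMod :=
  NormedSpace.ofCore (CStarModule.normedSpaceCore (FunctionAlg 𝓑))

end HilbertMod
namespace HilbertMod

variable {D}

open Classical in
/-- The element `e_{α,A} = (δ_{α,β} χ_A)_β` of `X`, for `A ∈ I_α`. -/
noncomputable def e (α : 𝓛) (A : D.I α) : D.HilbertMod :=
  (⟨fun β => if α = β then chi (A : 𝓑) else 0, fun β => by
      dsimp only
      split_ifs with h
      · subst h; exact chi_mem_chiSpan A.2
      · exact zero_mem _, by
      refine summable_of_ne_finset_zero (s := {α}) fun β hβ => ?_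
      have h : α ≠ β := by simpa [eq_comm] using hβ
      simp [h]⟩ : D.moduleCarrier)

/-- The underlying linear map of the left action `φ(f)(x_α) = (φ_α(f) x_α)`. -/
noncomputable def leftFun (f : FunctionAlg 𝓑) : D.HilbertMod →ₗ[ℂ] D.HilbertMod where
  toFun x := (⟨fun α => pull (D.isBoolAction α) f * x.coord α,
      fun α => mul_mem_chiSpan _ _ (x.coord_mem α), by
      refine summable_of_norm_sum_le (‖f‖ ^ 2) (x.summable_coord x) (x.summable_coord x)
        fun F => norm_le (by positivity) fun ξ => ?_
      have h0 : 0 ≤ ‖f‖ ^ 2 * ‖∑ α ∈ F, star (x.coord α) * x.coord α‖ := by positivity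
      refine le_trans ?_ (show ‖f‖ ^ 2 * ‖∑ α ∈ F, star (x.coord α) * x.coord α‖ ≤ _ by linarith)
      refine le_trans ?_ (mul_le_mul_of_nonneg_left (sum_sq_eval_le x.coord F ξ) (sq_nonneg _))
      rw [map_sum, Finset.mul_sum]
      refine (norm_sum_le _ _).trans (Finset.sum_le_sum fun α _ => ?_)
      rw [map_mul, map_star, norm_mul, norm_star, map_mul, norm_mul, ← sq, mul_pow]
      gcongr
      exact (norm_eval_le ξ _).trans (norm_pull_le _ f)⟩ : D.moduleCarrier)
  map_add' x y := ext_coord fun α => mul_add _ (x.coord α) (y.coord α)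
  map_smul' c x := ext_coord fun α => mul_smul_comm c _ (x.coord α)

theorem coord_leftFun (f : FunctionAlg 𝓑) (x : D.HilbertMod) (α : 𝓛) :
    (leftFun f x).coord α = pull (D.isBoolAction α) f * x.coord α := rfl

theorem norm_leftFun_le (f : FunctionAlg 𝓑) (x : D.HilbertMod) : ‖leftFun f x‖ ≤ ‖f‖ * ‖x‖ := by
  refine le_of_sq_le_sq ?_ (by positivity)
  rw [mul_pow, CStarModule.norm_sq_eq (FunctionAlg 𝓑) (x := leftFun f x),
    CStarModule.norm_sq_eq (FunctionAlg 𝓑) (x := x)]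
  refine norm_le (by positivity) fun ξ => ?_
  refine le_trans ?_ (mul_le_mul_of_nonneg_left (norm_eval_le ξ _) (sq_nonneg _))
  refine hasSum_le (fun α => ?_) ((leftFun f x).hasSum_eval_inner_self ξ)
    ((x.hasSum_eval_inner_self ξ).mul_left (‖f‖ ^ 2))
  rw [coord_leftFun, map_mul, norm_mul, mul_pow]
  gcongr
  exact (norm_eval_le ξ _).trans (norm_pull_le _ f)

end HilbertMod

end GenBoolDynSystem

/-! ### `C*`-correspondences, Toeplitz algebras and Cuntz-Pimsner algebras -/

/-- A `C*`-correspondence over a commutative `C*`-algebra `A`: a Hilbert `A`-module `X` with a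
`*`-homomorphism `φ` from `A` to the adjointable operators on `X`, the adjoint of `φ f` being
`φ (star f)`. -/
structure CStarCorrespondence (A X : Type*) [NonUnitalCommCStarAlgebra A] [PartialOrder A]
    [NormedAddCommGroup X] [NormedSpace ℂ X] [SMul A X] [CStarModule A X] where
  φ : A →ₙₐ[ℂ] (X →L[ℂ] X)
  inner_φ_left : ∀ (f : A) (x y : X), inner A (φ f x) y = inner A x (φ (star f) y)

namespace CStarCorrespondence

variable {A X : Type*} [NonUnitalCommCStarAlgebra A] [PartialOrder A]
  [NormedAddCommGroup X] [NormedSpace ℂ X] [SMul A X] [CStarModule A X]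

theorem eq_of_inner_eq {z w : X} (h : ∀ v : X, inner A v z = inner A v w) : z = w := by
  rw [← sub_eq_zero, ← CStarModule.inner_self (A := A)]
  have : z - w = z + (-1 : ℂ) • w := by simp [sub_eq_add_neg]
  rw [this, CStarModule.inner_add_right, CStarModule.inner_smul_right_complex, h]
  simp only [neg_smul, one_smul]
  abel

theorem norm_action_le (a : A) (x : X) : ‖a • x‖ ≤ ‖a‖ * ‖x‖ := by
  refine le_of_sq_le_sq ?_ (by positivity)
  rw [mul_pow, CStarModule.norm_sq_eq A (x := a • x), CStarModule.norm_sq_eq A (x := x),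
    CStarModule.inner_op_smul_right, CStarModule.inner_op_smul_left]
  refine (norm_mul_le _ _).trans ?_
  refine (mul_le_mul_of_nonneg_left (norm_mul_le _ _) (norm_nonneg _)).trans (le_of_eq ?_)
  rw [norm_star]; ring

variable (A) in
/-- The operator `Θ_{x,y}(z) = x ⟨y, z⟩`. -/
noncomputable def Θ [StarOrderedRing A] (x y : X) : X →L[ℂ] X :=
  LinearMap.mkContinuous
    { toFun := fun z => inner A y z • x
      map_add' := fun z w => eq_of_inner_eq (A := A) fun v => by
        simp only [CStarModule.inner_op_smul_right, CStarModule.inner_add_right, add_mul]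
      map_smul' := fun c z => eq_of_inner_eq (A := A) fun v => by
        simp only [CStarModule.inner_op_smul_right, CStarModule.inner_smul_right_complex,
          smul_mul_assoc, RingHom.id_apply] } (‖y‖ * ‖x‖) fun z => by
    refine (norm_action_le _ _).trans ?_
    calc ‖inner A y z‖ * ‖x‖ ≤ (‖y‖ * ‖z‖) * ‖x‖ := by
          gcongr; exact CStarModule.norm_inner_le X
      _ = ‖y‖ * ‖x‖ * ‖z‖ := by ring

variable (A X) in
/-- The generalized compact operators `𝔎(X)`: the closed linear span of the `Θ_{x,y}`. -/
noncomputable def compacts [StarOrderedRing A] : Submodule ℂ (X →L[ℂ] X) :=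
  (Submodule.span ℂ (Set.range fun p : X × X => Θ A p.1 p.2)).topologicalClosure

theorem Θ_mem_compacts [StarOrderedRing A] (x y : X) : Θ A x y ∈ compacts A X :=
  Submodule.le_topologicalClosure _ (Submodule.subset_span ⟨(x, y), rfl⟩)

variable (C : CStarCorrespondence A X)

/-- Katsura's ideal `J_X = φ⁻¹(𝔎(X)) ∩ (ker φ)^⊥`. -/
def katsuraIdeal [StarOrderedRing A] : Set A :=
  {f | C.φ f ∈ compacts A X ∧ ∀ g, C.φ g = 0 → f * g = 0}

/-- A (Toeplitz) representation `(π, t)` of the correspondence in a `C*`-algebra. -/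
structure Rep (𝒳 : Type*) [NonUnitalCStarAlgebra 𝒳] where
  π : A →⋆ₙₐ[ℂ] 𝒳
  t : X →ₗ[ℂ] 𝒳
  star_t_mul_t : ∀ x y, star (t x) * t y = π (inner A x y)
  π_mul_t : ∀ f x, π f * t x = t (C.φ f x)

namespace Rep

variable {C} {𝒳 : Type w} [NonUnitalCStarAlgebra 𝒳] (ρ : C.Rep 𝒳)

/-- `(π, t)` is `K`-coisometric: `π(f) = ψ_t(φ(f))` for `f ∈ K`, where `ψ_t` is the (unique)
continuous linear map on `𝔎(X)` with `ψ_t(Θ_{x,y}) = t(x) t(y)^*`. -/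
def IsCoisometric [StarOrderedRing A] (K : Set A) : Prop :=
  ∃ ψ : compacts A X →L[ℂ] 𝒳,
    (∀ x y, ψ ⟨Θ A x y, Θ_mem_compacts x y⟩ = ρ.t x * star (ρ.t y)) ∧
    ∀ f ∈ K, ∃ hf : C.φ f ∈ compacts A X, ρ.π f = ψ ⟨C.φ f, hf⟩

/-- The ambient `C*`-algebra is generated by the representation. -/
def Generates : Prop :=
  (NonUnitalStarAlgebra.adjoin ℂ (Set.range ρ.π ∪ Set.range ρ.t)).topologicalClosure = ⊤

/-- `𝒳` is the Toeplitz algebra `𝒯_X`: it is generated by the representation `(π, t)`, and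
`(π, t)` is universal among all representations of the correspondence. -/
def IsToeplitzAlgebra : Prop :=
  ρ.Generates ∧
  ∀ (𝒴 : Type w) [NonUnitalCStarAlgebra 𝒴] (σ : C.Rep 𝒴),
    ∃! Ψ : 𝒳 →⋆ₙₐ[ℂ] 𝒴, (∀ f, Ψ (ρ.π f) = σ.π f) ∧ ∀ x, Ψ (ρ.t x) = σ.t x

/-- `𝒳` is the relative Cuntz-Pimsner algebra `𝒪_(K,X)`: it is generated by the `K`-coisometric
representation `(π, t)`, and `(π, t)` is universal among all `K`-coisometric representations. -/
def IsRelCuntzPimsnerAlgebra [StarOrderedRing A] (K : Set A) : Prop :=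
  ρ.IsCoisometric K ∧ ρ.Generates ∧
  ∀ (𝒴 : Type w) [NonUnitalCStarAlgebra 𝒴] (σ : C.Rep 𝒴), σ.IsCoisometric K →
    ∃! Ψ : 𝒳 →⋆ₙₐ[ℂ] 𝒴, (∀ f, Ψ (ρ.π f) = σ.π f) ∧ ∀ x, Ψ (ρ.t x) = σ.t x

/-- `𝒳` is the Cuntz-Pimsner algebra `𝒪_X`, the relative Cuntz-Pimsner algebra for Katsura's
ideal `J_X`. -/
def IsCuntzPimsnerAlgebra [StarOrderedRing A] : Prop :=
  ρ.IsRelCuntzPimsnerAlgebra C.katsuraIdeal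

end Rep

end CStarCorrespondence

/-! ### The correspondence and the `C*`-algebras of a generalized Boolean dynamical system -/

namespace GenBoolDynSystem

open FunctionAlg HilbertMod

variable {𝓑 𝓛 : Type*} [GeneralizedBooleanAlgebra 𝓑] (D : GenBoolDynSystem 𝓑 𝓛)

/-- The `C*`-correspondence `X(𝓑, 𝓛, θ, I)` over `𝒜(𝓑)`, with left action
`φ(f)(x_α) = (φ_α(f) x_α)`, where `φ_α(χ_A) = χ_{θ_α(A)}`. -/
noncomputable def correspondence : CStarCorrespondence (FunctionAlg 𝓑) D.HilbertMod where
  φ :=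
    { toFun := fun f => (leftFun f).mkContinuous ‖f‖ (norm_leftFun_le f)
      map_smul' := fun c f => by
        ext x
        exact ext_coord fun α => by
          change pull (D.isBoolAction α) (c • f) * x.coord α = c • (pull (D.isBoolAction α) f * x.coord α)
          rw [map_smul, smul_mul_assoc]
      map_zero' := by
        ext x
        exact ext_coord fun α => by
          change pull (D.isBoolAction α) 0 * x.coord α = 0
          rw [map_zero, zero_mul]
      map_add' := fun f g => by
        ext x
        exact ext_coord fun α => by
          change pull (D.isBoolAction α) (f + g) * x.coord α =
            pull (D.isBoolAction α) f * x.coord α + pull (D.isBoolAction α) g * x.coord α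
          rw [map_add, add_mul]
      map_mul' := fun f g => by
        ext x
        exact ext_coord fun α => by
          change pull (D.isBoolAction α) (f * g) * x.coord α =
            pull (D.isBoolAction α) f * (pull (D.isBoolAction α) g * x.coord α)
          rw [map_mul, mul_assoc] }
  inner_φ_left f x y := by
    refine tsum_congr fun α => ?_
    change star (pull (D.isBoolAction α) f * x.coord α) * y.coord α =
      star (x.coord α) * (pull (D.isBoolAction α) (star f) * y.coord α)
    rw [star_mul, map_star, mul_assoc]

/-- `Δ_B = {α | θ_α(B) ≠ ∅}`. -/
def Δ (B : 𝓑) : Set 𝓛 := {α | D.θ α B ≠ ⊥}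

/-- `𝓑_reg`: the set of all `A` such that `0 < |Δ_B| < ∞` for all non-empty `B ⊆ A`. -/
def reg : Set 𝓑 := {A | ∀ B ≤ A, B ≠ ⊥ → (D.Δ B).Nonempty ∧ (D.Δ B).Finite}

theorem mem_I (α : 𝓛) (A : 𝓑) : D.θ α A ∈ D.I α := D.range_subset α ⟨A, le_rfl⟩

open Classical in
/-- A representation of `(𝓑, 𝓛, θ, I)` relative to a set `J` of regular elements of `𝓑`: a family
of projections `P_A` and of partial isometries `S_{α,B}`, `B ∈ I_α`, subject to the relations
(i)-(iv) below; (iv) is imposed for `A ∈ J` only. -/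
structure Rep (J : Set 𝓑) (𝒳 : Type*) [NonUnitalCStarAlgebra 𝒳] where
  P : 𝓑 → 𝒳
  S : (α : 𝓛) → D.I α → 𝒳
  isStarProjection_P : ∀ A, IsStarProjection (P A)
  partialIsometry_S : ∀ α B, S α B * star (S α B) * S α B = S α B
  P_bot : P ⊥ = 0
  P_inf : ∀ A A', P (A ⊓ A') = P A * P A'
  P_sup : ∀ A A', P (A ⊔ A') = P A + P A' - P (A ⊓ A')
  P_mul_S : ∀ A α B, P A * S α B = S α B * P (D.θ α A)
  star_S_mul_S : ∀ α α' (B : D.I α) (B' : D.I α'),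
    star (S α B) * S α' B' = if α = α' then P ((B : 𝓑) ⊓ (B' : 𝓑)) else 0
  P_eq_sum : ∀ A ∈ J,
    P A = ∑ᶠ α ∈ D.Δ A, S α ⟨D.θ α A, D.mem_I α A⟩ * star (S α ⟨D.θ α A, D.mem_I α A⟩)

namespace Rep

variable {D} {J : Set 𝓑} {𝒳 : Type w} [NonUnitalCStarAlgebra 𝒳] (R : D.Rep J 𝒳)

/-- `𝒳` is generated by `{P_A, S_{α,B}}`, and `{P_A, S_{α,B}}` is universal among all
representations relative to `J`; that is, `𝒳 = C*(𝓑, 𝓛, θ, I; J)`. -/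
def IsUniversal : Prop :=
  (NonUnitalStarAlgebra.adjoin ℂ
    (Set.range R.P ∪ Set.range fun p : Σ α, D.I α => R.S p.1 p.2)).topologicalClosure = ⊤ ∧
  ∀ (𝒴 : Type w) [NonUnitalCStarAlgebra 𝒴] (Q : D.Rep J 𝒴),
    ∃! Ψ : 𝒳 →⋆ₙₐ[ℂ] 𝒴, (∀ A, Ψ (R.P A) = Q.P A) ∧ ∀ α B, Ψ (R.S α B) = Q.S α B

end Rep

/-- Toeplitz representations: relation (iv) is not imposed at all. -/
abbrev ToeplitzRep (𝒳 : Type*) [NonUnitalCStarAlgebra 𝒳] := D.Rep ∅ 𝒳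

/-- Cuntz-Krieger representations: relation (iv) is imposed for all regular elements. -/
abbrev CuntzKriegerRep (𝒳 : Type*) [NonUnitalCStarAlgebra 𝒳] := D.Rep D.reg 𝒳

end GenBoolDynSystem

/-! A representation of the system and a representation of its correspondence carry the same
information, so universal objects of one kind are universal objects of the other. The whole proof
consists in making this translation and matching the extra relations.

From `{P, S}` to `(π, t)` (`Rep.exists_corrRep`). The projections `P A` commute and generate a
commutative algebra. A character of it restricts to a `{0,1}`-valued homomorphism on `𝓑`, hence is a
point of the spectrum or zero. Gelfand theory then bounds every `*`-polynomial in the `P A` by the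
same polynomial in the `χ_A`, which yields `π`. The vectors `e α A` have dense span in `X`, and
relation (iii) says that the `S α A` have the inner products of the `e α A`, transported by `π`; so
`e α A ↦ S α A` extends to a contraction `t`. Relation (ii) becomes compatibility with the left
action. The converse, `Rep.ofCorr`, is evaluation at `χ_A` and `e α B`.

Relation (iv). If `Δ_A` is finite, then `φ(χ_A)` is the finite sum of the rank-one operators of the
vectors `e α (θ_α A)` (`φ_chi_eq_sum`). For regular `A`, relation (iv) therefore reads `π(χ_A) =
ψ_t(φ(χ_A))`, and by continuity it amounts to coisometricity on the closed span of the regular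
`χ_A`. That `ψ_t` exists at all is the estimate `norm_le_of_mem_compactGraph`.

Katsura's ideal (`katsuraIdeal_eq`). For regular `A`, `φ(χ_A)` is compact, and `χ_A` kills `ker φ`
because every non-empty part of `A` is moved to something non-empty by some `θ_α`. Conversely, if
`f` lies in `J_X` and `|f|` exceeds a positive constant on `Z A`, then `A` is regular: a part killed
by every `θ_α` would lie in `ker φ`, and a part with infinite `Δ` would keep the compact operator
`φ(f)` large in infinitely many coordinates. Compactness of `{|f| ≥ ε/2}` then approximates `f` by
`f χ_A` with `A` regular.

Existence. The universal representation of the system lives in an `ℓ^∞`-product over one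
representation for each possible norm function on `*`-polynomials; its extension `(π, t)` is
universal for the correspondence. -/

/-! ### Extending bounded maps given by their graphs -/

section Extension

variable {E F : Type*} [NormedAddCommGroup E] [NormedSpace ℂ E] [NormedAddCommGroup F]
  [NormedSpace ℂ F] [CompleteSpace F]

/-- A subspace of `E × F` that is the graph of a bounded map with dense domain extends to the graph
of a continuous linear map. -/
theorem Submodule.exists_clm_of_graph (G : Submodule ℂ (E × F)) {C : ℝ}
    (hG : ∀ p ∈ G, ‖p.2‖ ≤ C * ‖p.1‖) (hd : ∀ x, x ∈ closure (Prod.fst '' (G : Set (E × F)))) :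
    ∃ f : E →L[ℂ] F, (∀ p ∈ G, f p.1 = p.2) ∧ ∀ x, ‖f x‖ ≤ C * ‖x‖ := by
  have hden : DenseRange ((LinearMap.fst ℂ E F).comp G.subtype) := by
    intro x
    refine closure_mono ?_ (hd x)
    rintro _ ⟨p, hp, rfl⟩
    exact ⟨⟨p, hp⟩, rfl⟩
  have hb : ∀ p : G, ‖(LinearMap.snd ℂ E F).comp G.subtype p‖ ≤
      C * ‖(LinearMap.fst ℂ E F).comp G.subtype p‖ := fun p => hG p p.2
  exact ⟨((LinearMap.snd ℂ E F).comp G.subtype).extendOfNorm ((LinearMap.fst ℂ E F).comp G.subtype),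
    fun p hp => LinearMap.extendOfNorm_eq hden ⟨C, hb⟩ ⟨p, hp⟩,
    LinearMap.norm_extendOfNorm_apply_le hden C hb⟩

/-- A family of vectors of `F` that depends boundedly on a family of vectors of `E` is the image of
the latter under a continuous linear map on its closed linear span. -/
theorem exists_clm_topologicalClosure_span {ι : Type*} (a : ι → E) (b : ι → F) {C : ℝ}
    (h : ∀ p ∈ Submodule.span ℂ (Set.range fun i => (a i, b i)), ‖p.2‖ ≤ C * ‖p.1‖) :
    ∃ ψ : (Submodule.span ℂ (Set.range a)).topologicalClosure →L[ℂ] F,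
      ∀ i (hi : a i ∈ (Submodule.span ℂ (Set.range a)).topologicalClosure), ψ ⟨a i, hi⟩ = b i := by
  set V := (Submodule.span ℂ (Set.range a)).topologicalClosure with hV
  set H := Submodule.span ℂ (Set.range fun i => (a i, b i)) with hH
  -- The graph is pulled back to the closed span `V`, inside which its domain becomes dense.
  let j : (V × F) →ₗ[ℂ] E × F := V.subtype.prodMap LinearMap.id
  have hfst : ∀ x ∈ Submodule.span ℂ (Set.range a), ∃ s, (x, s) ∈ H := by
    intro x hx
    induction hx using Submodule.span_induction with
    | mem x h =>
      obtain ⟨i, rfl⟩ := h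
      exact ⟨b i, Submodule.subset_span ⟨i, rfl⟩⟩
    | zero => exact ⟨0, zero_mem H⟩
    | add x y _ _ hx hy =>
      obtain ⟨s, hs⟩ := hx
      obtain ⟨r, hr⟩ := hy
      exact ⟨s + r, add_mem hs hr⟩
    | smul c x _ hx =>
      obtain ⟨s, hs⟩ := hx
      exact ⟨c • s, Submodule.smul_mem _ c hs⟩
  have hd : ∀ x : V, x ∈ closure (Prod.fst '' (H.comap j : Set (V × F))) := by
    rintro ⟨x, hx⟩
    rw [Topology.IsInducing.subtypeVal.closure_eq_preimage_closure_image]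
    refine closure_mono ?_ (show x ∈ closure _ from hx)
    intro y hy
    obtain ⟨s, hs⟩ := hfst y hy
    exact ⟨⟨y, Submodule.le_topologicalClosure _ hy⟩,
      ⟨(⟨y, Submodule.le_topologicalClosure _ hy⟩, s), hs, rfl⟩, rfl⟩
  obtain ⟨ψ, hψ, -⟩ := (H.comap j).exists_clm_of_graph (fun p hp => h (j p) hp) hd
  exact ⟨ψ, fun i hi => hψ (⟨a i, hi⟩, b i) (Submodule.subset_span ⟨i, rfl⟩)⟩

end Extension

/-- A star subalgebra of `𝒳 × 𝒴` that is the graph of a contraction with dense domain extends to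
the graph of a `*`-homomorphism. -/
theorem NonUnitalStarSubalgebra.exists_starHom_of_graph {𝒳 𝒴 : Type*} [NonUnitalCStarAlgebra 𝒳]
    [NonUnitalCStarAlgebra 𝒴] (G : NonUnitalStarSubalgebra ℂ (𝒳 × 𝒴))
    (hG : ∀ p ∈ G, ‖p.2‖ ≤ ‖p.1‖) (hd : ∀ x, x ∈ closure (Prod.fst '' (G : Set (𝒳 × 𝒴)))) :
    ∃ Ψ : 𝒳 →⋆ₙₐ[ℂ] 𝒴, ∀ p ∈ G, Ψ p.1 = p.2 := by
  obtain ⟨f, hf, -⟩ := G.toNonUnitalSubalgebra.toSubmodule.exists_clm_of_graph (C := 1)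
    (fun p hp => by simpa using hG p hp) hd
  replace hf : ∀ p ∈ G, f p.1 = p.2 := hf
  -- Multiplicativity passes to the closure in one variable at a time, the other being held in the
  -- domain of the graph first.
  have hmul : ∀ x y, f (x * y) = f x * f y := by
    intro x y
    have h1 : ∀ q ∈ G, ∀ x, f (x * q.1) = f x * f q.1 := by
      intro q hq x
      have hc : IsClosed {x | f (x * q.1) = f x * f q.1} :=
        isClosed_eq (by fun_prop) (by fun_prop)
      refine closure_minimal ?_ hc (hd x)
      rintro _ ⟨p, hp, rfl⟩
      have := hf _ (mul_mem hp hq)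
      rw [Prod.fst_mul, Prod.snd_mul] at this
      rw [Set.mem_ofPred_eq, this, hf p hp, hf q hq]
    have hc : IsClosed {y | f (x * y) = f x * f y} := isClosed_eq (by fun_prop) (by fun_prop)
    refine closure_minimal ?_ hc (hd y)
    rintro _ ⟨q, hq, rfl⟩
    exact h1 q hq x
  have hstar : ∀ x, f (star x) = star (f x) := by
    intro x
    have hc : IsClosed {x | f (star x) = star (f x)} := isClosed_eq (by fun_prop) (by fun_prop)
    refine closure_minimal ?_ hc (hd x)
    rintro _ ⟨p, hp, rfl⟩
    have := hf _ (star_mem hp)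
    rw [Prod.fst_star, Prod.snd_star] at this
    rw [Set.mem_ofPred_eq, this, hf p hp]
  exact ⟨{ f with
      map_zero' := map_zero f
      map_mul' := hmul
      map_star' := hstar
      map_smul' := fun c x => map_smul f c x }, hf⟩

/-! ### Norm estimates from characters and from powers -/

open Unitization in
/-- In a commutative `C*`-algebra the characters compute the norm. -/
theorem norm_le_of_forall_character {S : Type*} [NonUnitalCommCStarAlgebra S] {x : S} {M : ℝ}
    (hM : 0 ≤ M) (h : ∀ φ : S →⋆ₙₐ[ℂ] ℂ, ‖φ x‖ ≤ M) : ‖x‖ ≤ M := by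
  rw [← Unitization.norm_inr (𝕜 := ℂ) x]
  have hiso := gelfandTransform_isometry (Unitization ℂ S)
  rw [← hiso.norm_map_of_map_zero (map_zero _), ContinuousMap.norm_le _ hM]
  intro φ
  exact h (((φ : Unitization ℂ S →⋆ₐ[ℂ] ℂ) : Unitization ℂ S →⋆ₙₐ[ℂ] ℂ).comp
    (inrNonUnitalStarAlgHom ℂ S))

/-- Multiplying `c` on the left by itself `2 ^ n - 1` times gives the power `c ^ (2 ^ n)`; iterates
express this without a unit. In the unitization the `C*`-identity evaluates the norm of that power.
-/
theorem IsSelfAdjoint.norm_iterate_mul {𝒳 : Type*} [NonUnitalCStarAlgebra 𝒳] {c : 𝒳}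
    (hc : IsSelfAdjoint c) (n : ℕ) : ‖(c * ·)^[2 ^ n - 1] c‖ = ‖c‖ ^ 2 ^ n := by
  have h : ∀ m, (((c * ·)^[m] c : 𝒳) : Unitization ℂ 𝒳) = (c : Unitization ℂ 𝒳) ^ (m + 1) := by
    intro m
    induction m with
    | zero => simp
    | succ m ih => rw [Function.iterate_succ_apply', Unitization.inr_mul, ih, ← pow_succ']
  have hs : IsSelfAdjoint (c : Unitization ℂ 𝒳) := by
    rw [isSelfAdjoint_iff, ← Unitization.inr_star, hc.star_eq]
  rw [← Unitization.norm_inr (𝕜 := ℂ) ((c * ·)^[2 ^ n - 1] c), h,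
    Nat.sub_add_cancel Nat.one_le_two_pow, hs.norm_pow_two_pow, Unitization.norm_inr]

/-- If `v ^ (2 ^ n) ≤ C r ^ (2 ^ n - 1)` for all `n`, then `v ≤ r`. -/
theorem le_of_pow_two_pow_le {v r C : ℝ} (hr : 0 ≤ r)
    (h : ∀ n, v ^ 2 ^ n ≤ C * r ^ (2 ^ n - 1)) : v ≤ r := by
  by_contra! hlt
  have hv' : 0 < v := hr.trans_lt hlt
  -- If `r < v`, dividing the hypothesis by `v ^ (2 ^ n - 1)` bounds `v` by a sequence that tends to
  -- zero.
  have h1 : Filter.Tendsto (fun n : ℕ => C * (r / v) ^ (2 ^ n - 1)) Filter.atTop (nhds (C * 0)) := by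
    refine Filter.Tendsto.const_mul _ ((tendsto_pow_atTop_nhds_zero_of_lt_one (by positivity)
      ((div_lt_one hv').2 hlt)).comp ?_)
    refine Filter.tendsto_atTop_mono (fun n => ?_) Filter.tendsto_id
    have := Nat.lt_two_pow_self (n := n)
    simp only [id]; omega
  rw [mul_zero] at h1
  refine absurd (ge_of_tendsto' h1 fun n => ?_) (not_le.2 hv')
  rw [div_pow, mul_div_assoc', le_div_iff₀ (by positivity), ← pow_succ',
    Nat.sub_add_cancel Nat.one_le_two_pow]
  exact h n

/-! ### Representations of a correspondence and the map `ψ_t` on compact operators -/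

namespace CStarCorrespondence

variable {A X : Type*} [NonUnitalCommCStarAlgebra A] [PartialOrder A]
  [NormedAddCommGroup X] [NormedSpace ℂ X] [SMul A X] [CStarModule A X]
  {C : CStarCorrespondence A X} {𝒳 : Type*} [NonUnitalCStarAlgebra 𝒳]

/-- A linear map that intertwines the inner products also intertwines the right actions. -/
theorem mul_eq_of_star_mul_eq {π : A →⋆ₙₐ[ℂ] 𝒳} {t : X → 𝒳}
    (h : ∀ x y, star (t x) * t y = π (inner A x y)) (x : X) (f : A) : t x * π f = t (f • x) := by
  -- All four products formed from `t x * π f` and `t (f • x)` coincide, so the difference `d`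
  -- satisfies `d^* d = 0`.
  have h1 : star (t x * π f) * (t x * π f) = π (star f * inner A x x * f) := by
    rw [star_mul, mul_assoc, ← mul_assoc (star (t x)), h, ← map_star, ← map_mul,
      ← map_mul, mul_assoc]
  have h2 : star (t x * π f) * t (f • x) = π (star f * inner A x x * f) := by
    rw [star_mul, mul_assoc, h, ← map_star, ← map_mul,
      CStarModule.inner_op_smul_right, mul_comm f, mul_assoc]
  have h3 : star (t (f • x)) * (t x * π f) = π (star f * inner A x x * f) := by
    rw [← mul_assoc, h, ← map_mul, CStarModule.inner_op_smul_left, mul_comm (star f)]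
  have h4 : star (t (f • x)) * t (f • x) = π (star f * inner A x x * f) := by
    rw [h, CStarModule.inner_op_smul_left, CStarModule.inner_op_smul_right,
      mul_comm _ (star f), mul_comm f, mul_assoc]
  rw [← sub_eq_zero, ← CStarRing.star_mul_self_eq_zero_iff, star_sub, sub_mul, mul_sub, mul_sub,
    h1, h2, h3, h4]
  simp

namespace Rep

variable (ρ : C.Rep 𝒳)

theorem norm_π_le (f : A) : ‖ρ.π f‖ ≤ ‖f‖ := NonUnitalStarAlgHom.norm_apply_le ρ.π f

theorem continuous_π : Continuous ρ.π :=
  AddMonoidHomClass.continuous_of_bound ρ.π 1 fun f => by simpa using ρ.norm_π_le f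

theorem norm_t_le (x : X) : ‖ρ.t x‖ ≤ ‖x‖ := by
  refine le_of_sq_le_sq ?_ (norm_nonneg _)
  rw [CStarModule.norm_sq_eq A (x := x), sq, ← CStarRing.norm_star_mul_self, ρ.star_t_mul_t]
  exact NonUnitalStarAlgHom.norm_apply_le ρ.π _

theorem continuous_t : Continuous ρ.t :=
  AddMonoidHomClass.continuous_of_bound ρ.t 1 fun x => by simpa using ρ.norm_t_le x

theorem t_mul_π (x : X) (f : A) : ρ.t x * ρ.π f = ρ.t (f • x) :=
  mul_eq_of_star_mul_eq ρ.star_t_mul_t x f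

end Rep

variable [StarOrderedRing A]

theorem continuous_inner_left (y : X) : Continuous fun x : X => inner A x y :=
  CStarModule.continuous_inner.comp (Continuous.prodMk_left y)

theorem continuous_inner_right (x : X) : Continuous fun y : X => inner A x y :=
  CStarModule.continuous_inner.comp (Continuous.prodMk_right x)

theorem Θ_apply (x y z : X) : Θ A x y z = inner A y z • x := rfl

theorem inner_Θ_left (x y z w : X) : inner A (Θ A x y z) w = inner A z (Θ A y x w) := by
  rw [Θ_apply, Θ_apply, CStarModule.inner_op_smul_right, CStarModule.inner_op_smul_left,
    CStarModule.star_inner, mul_comm]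

/-- An adjoint of an operator has at most its norm. -/
theorem norm_adjoint_le {T T' : X →L[ℂ] X} (h : ∀ z w, inner A (T z) w = inner A z (T' w)) :
    ‖T'‖ ≤ ‖T‖ := by
  refine T'.opNorm_le_bound (norm_nonneg _) fun w => ?_
  rcases (norm_nonneg (T' w)).eq_or_lt with h0 | h0
  · rw [← h0]; positivity
  -- Cauchy-Schwarz applied to `‖T' w‖ ^ 2 = ‖⟨T (T' w), w⟩‖`, after which one factor `‖T' w‖`
  -- cancels.
  · refine le_of_mul_le_mul_right ?_ h0
    rw [← sq, CStarModule.norm_sq_eq A, ← h]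
    calc ‖inner A (T (T' w)) w‖ ≤ ‖T (T' w)‖ * ‖w‖ := CStarModule.norm_inner_le X
      _ ≤ ‖T‖ * ‖T' w‖ * ‖w‖ := by gcongr; exact T.le_opNorm _
      _ = ‖T‖ * ‖w‖ * ‖T' w‖ := by ring

namespace Rep

variable (ρ : C.Rep 𝒳)

/-- The linear span of the pairs `(Θ_{x,y}, t(x) t(y)^*)`. -/
noncomputable def compactGraph : Submodule ℂ ((X →L[ℂ] X) × 𝒳) :=
  Submodule.span ℂ (Set.range fun p : X × X => (Θ A p.1 p.2, ρ.t p.1 * star (ρ.t p.2)))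

variable {ρ}

/-- On generators, `t(x) t(y)^* t(z) = t(x) π⟨y, z⟩ = t(x⟨y, z⟩)`. Thus left multiplication by `p.2`
on `t(X)` is governed by the operator `p.1`. -/
theorem mul_t_of_mem_compactGraph {p : (X →L[ℂ] X) × 𝒳} (hp : p ∈ ρ.compactGraph) (z : X) :
    p.2 * ρ.t z = ρ.t (p.1 z) := by
  induction hp using Submodule.span_induction with
  | mem p h =>
    obtain ⟨⟨x, y⟩, rfl⟩ := h
    rw [mul_assoc, ρ.star_t_mul_t, t_mul_π, Θ_apply]
  | zero => simp
  | add p q _ _ hp hq => simp [add_mul, hp, hq]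
  | smul c p _ hp => simp [smul_mul_assoc, hp]

theorem exists_adjoint_mem_compactGraph {p : (X →L[ℂ] X) × 𝒳} (hp : p ∈ ρ.compactGraph) :
    ∃ T' : X →L[ℂ] X, (T', star p.2) ∈ ρ.compactGraph ∧
      ∀ z w, inner A (p.1 z) w = inner A z (T' w) := by
  induction hp using Submodule.span_induction with
  | mem p h =>
    obtain ⟨⟨x, y⟩, rfl⟩ := h
    exact ⟨Θ A y x, Submodule.subset_span ⟨(y, x), by simp⟩, inner_Θ_left x y⟩
  | zero => exact ⟨0, by rw [Prod.snd_zero, star_zero]; exact zero_mem ρ.compactGraph, by simp⟩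
  | add p q _ _ hp hq =>
    obtain ⟨T, hT, hT'⟩ := hp
    obtain ⟨U, hU, hU'⟩ := hq
    exact ⟨T + U, by simpa using add_mem hT hU, fun z w => by
      simp [CStarModule.inner_add_left, CStarModule.inner_add_right, hT', hU']⟩
  | smul c p _ hp =>
    obtain ⟨T, hT, hT'⟩ := hp
    exact ⟨star c • T, by simpa using Submodule.smul_mem _ (star c) hT, fun z w => by
      simp [CStarModule.inner_smul_left_complex, CStarModule.inner_smul_right_complex, hT']⟩

/-- A crude estimate: for a combination of the `t(x_i) t(y_i)^*`, the constant collects the products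
`‖x_i‖ ‖y_i‖` weighted by the coefficients. What matters is that it does not depend on `b` or `L`,
since taking high roots will remove it. -/
theorem exists_norm_mul_le_of_mem_compactGraph {p : (X →L[ℂ] X) × 𝒳} (hp : p ∈ ρ.compactGraph) :
    ∃ K, 0 ≤ K ∧ ∀ (b : 𝒳) (L : X →L[ℂ] X), (∀ z, b * ρ.t z = ρ.t (L z)) →
      ‖b * p.2‖ ≤ K * ‖L‖ := by
  induction hp using Submodule.span_induction with
  | mem p h =>
    obtain ⟨⟨x, y⟩, rfl⟩ := h
    refine ⟨‖x‖ * ‖y‖, by positivity, fun b L hb => ?_⟩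
    rw [← mul_assoc, hb]
    calc ‖ρ.t (L x) * star (ρ.t y)‖ ≤ ‖ρ.t (L x)‖ * ‖star (ρ.t y)‖ := norm_mul_le _ _
      _ ≤ (‖L‖ * ‖x‖) * ‖y‖ := by
        rw [norm_star]
        gcongr
        exacts [(ρ.norm_t_le _).trans (L.le_opNorm _), ρ.norm_t_le _]
      _ = ‖x‖ * ‖y‖ * ‖L‖ := by ring
  | zero => exact ⟨0, le_rfl, by simp⟩
  | add p q _ _ hp hq =>
    obtain ⟨K, hK, hp⟩ := hp
    obtain ⟨M, hM, hq⟩ := hq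
    refine ⟨K + M, by positivity, fun b L hb => ?_⟩
    rw [Prod.snd_add, mul_add, add_mul]
    exact (norm_add_le _ _).trans (add_le_add (hp b L hb) (hq b L hb))
  | smul c p _ hp =>
    obtain ⟨K, hK, hp⟩ := hp
    refine ⟨‖c‖ * K, by positivity, fun b L hb => ?_⟩
    rw [show (c • p).2 = c • p.2 from rfl, mul_smul_comm, norm_smul, mul_assoc]
    exact mul_le_mul_of_nonneg_left (hp b L hb) (norm_nonneg _)

/-- Write `s = p.2`, `T = p.1` and `c = s^* s`. The element `c^m s^*` acts on `t(X)` through an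
operator of norm at most `‖T'‖ ‖T‖ ^ (2 m)`, so the crude estimate bounds `‖c ^ (m + 1)‖ = ‖c^m s^*
s‖` by a constant times `‖T‖ ^ (2 m)`. With `m + 1 = 2 ^ n` the left side is `‖c‖ ^ (2 ^ n)`, and
letting `n` grow leaves `‖s‖ ^ 2 = ‖c‖ ≤ ‖T‖ ^ 2`. This makes `ψ_t` well defined and contractive,
with no faithfulness assumption on `π`. -/
theorem norm_le_of_mem_compactGraph {p : (X →L[ℂ] X) × 𝒳} (hp : p ∈ ρ.compactGraph) :
    ‖p.2‖ ≤ ‖p.1‖ := by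
  obtain ⟨T', hT', hadj⟩ := exists_adjoint_mem_compactGraph hp
  obtain ⟨K, hK, hbd⟩ := exists_norm_mul_le_of_mem_compactGraph hp
  set R : X →L[ℂ] X := T'.comp p.1 with hR
  have hRn : ‖R‖ ≤ ‖p.1‖ ^ 2 := by
    rw [sq]
    exact (T'.opNorm_comp_le p.1).trans (by gcongr; exact norm_adjoint_le hadj)
  -- the powers of `c = s^* s` act on `t(X)` through the powers of `R`
  have hact : ∀ m, ∃ L : X →L[ℂ] X, ‖L‖ ≤ ‖T'‖ * (‖p.1‖ ^ 2) ^ m ∧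
      ∀ z, (star p.2 * p.2 * ·)^[m] (star p.2) * ρ.t z = ρ.t (L z) := by
    intro m
    induction m with
    | zero => exact ⟨T', by simp, fun z => mul_t_of_mem_compactGraph hT' z⟩
    | succ m ih =>
      obtain ⟨L, hL, hLz⟩ := ih
      refine ⟨R.comp L, ?_, fun z => ?_⟩
      · calc ‖R.comp L‖ ≤ ‖R‖ * ‖L‖ := R.opNorm_comp_le L
          _ ≤ ‖p.1‖ ^ 2 * (‖T'‖ * (‖p.1‖ ^ 2) ^ m) := by gcongr
          _ = _ := by ring
      · rw [Function.iterate_succ_apply', mul_assoc, hLz, mul_assoc, mul_t_of_mem_compactGraph hp]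
        exact mul_t_of_mem_compactGraph hT' _
  have hmul : ∀ m, (star p.2 * p.2 * ·)^[m] (star p.2) * p.2 =
      (star p.2 * p.2 * ·)^[m] (star p.2 * p.2) := by
    intro m
    induction m with
    | zero => rfl
    | succ m ih => rw [Function.iterate_succ_apply', Function.iterate_succ_apply', mul_assoc, ih]
  refine le_of_sq_le_sq ?_ (norm_nonneg _)
  rw [sq ‖p.2‖, ← CStarRing.norm_star_mul_self]
  refine le_of_pow_two_pow_le (C := K * ‖T'‖) (by positivity) fun n => ?_
  rw [← (IsSelfAdjoint.star_mul_self p.2).norm_iterate_mul, ← hmul, mul_assoc]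
  obtain ⟨L, hL, hLz⟩ := hact (2 ^ n - 1)
  exact (hbd _ L hLz).trans (mul_le_mul_of_nonneg_left hL hK)

variable (ρ)

/-- The homomorphism `ψ_t` of the compact operators exists for every representation. -/
theorem exists_compactsMap : ∃ ψ : compacts A X →L[ℂ] 𝒳,
    ∀ x y, ψ ⟨Θ A x y, Θ_mem_compacts x y⟩ = ρ.t x * star (ρ.t y) := by
  obtain ⟨ψ, hψ⟩ := exists_clm_topologicalClosure_span
    (fun p : X × X => Θ A p.1 p.2) (fun p => ρ.t p.1 * star (ρ.t p.2)) (C := 1)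
    fun p hp => by rw [one_mul]; exact norm_le_of_mem_compactGraph hp
  exact ⟨ψ, fun x y => hψ (x, y) _⟩

end Rep

end CStarCorrespondence

/-! ### Universality of the function algebra for Boolean representations by projections -/

namespace FunctionAlg

variable {𝓑 : Type*} [GeneralizedBooleanAlgebra 𝓑] {𝒳 : Type*} [NonUnitalCStarAlgebra 𝒳]

theorem continuous_starHom (π : FunctionAlg 𝓑 →⋆ₙₐ[ℂ] 𝒳) : Continuous π :=
  AddMonoidHomClass.continuous_of_bound π 1 fun f => by
    simpa using NonUnitalStarAlgHom.norm_apply_le π f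

/-- A closed property that is compatible with linear combinations holds on `𝒜(𝓑)` if it holds for
the functions `χ_A`. -/
theorem induction_chi {p : FunctionAlg 𝓑 → Prop} (hp : IsClosed {f | p f}) (chi : ∀ A, p (chi A))
    (zero : p 0) (add : ∀ f g, p f → p g → p (f + g)) (smul : ∀ (c : ℂ) f, p f → p (c • f))
    (f : FunctionAlg 𝓑) : p f := by
  refine closure_minimal (fun f hf => ?_) hp (mem_closure_span_chi f)
  rw [Set.mem_ofPred_eq]
  induction hf using Submodule.span_induction with
  | mem _ h =>
    obtain ⟨A, rfl⟩ := h
    exact chi A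
  | zero => exact zero
  | add x y _ _ hx hy => exact add x y hx hy
  | smul c x _ hx => exact smul c x hx

theorem starHom_ext {π σ : FunctionAlg 𝓑 →⋆ₙₐ[ℂ] 𝒳} (h : ∀ A, π (chi A) = σ (chi A)) : π = σ := by
  ext f
  induction f using induction_chi with
  | hp => exact isClosed_eq (continuous_starHom π) (continuous_starHom σ)
  | chi A => exact h A
  | zero => simp
  | add f g hf hg => simp [hf, hg]
  | smul c f hf => simp [hf]

theorem chi_bot : chi (⊥ : 𝓑) = 0 := by
  classical
  refine ext_eval fun ξ => ?_
  rw [eval_chi, if_neg ξ.bot_notMem, map_zero]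

theorem chi_sup (A B : 𝓑) : chi (A ⊔ B) = chi A + chi B - chi (A ⊓ B) := by
  classical
  refine ext_eval fun ξ => ?_
  rw [map_sub, map_add, eval_chi, eval_chi, eval_chi, eval_chi]
  have h1 : A ⊓ B ∈ ξ.carrier ↔ A ∈ ξ.carrier ∧ B ∈ ξ.carrier :=
    ⟨fun h => ⟨ξ.mem_of_le h inf_le_left, ξ.mem_of_le h inf_le_right⟩, fun h => ξ.inf_mem h.1 h.2⟩
  have h2 : A ⊔ B ∈ ξ.carrier ↔ A ∈ ξ.carrier ∨ B ∈ ξ.carrier :=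
    ⟨ξ.mem_or_mem, fun h => h.elim (fun h => ξ.mem_of_le h le_sup_left)
      fun h => ξ.mem_of_le h le_sup_right⟩
  by_cases hA : A ∈ ξ.carrier <;> by_cases hB : B ∈ ξ.carrier <;> simp [hA, hB, h1, h2]

theorem isStarProjection_chi (A : 𝓑) : IsStarProjection (chi A) :=
  ⟨by rw [IsIdempotentElem, chi_mul_chi, inf_idem], star_chi A⟩

theorem norm_chi_le (A : 𝓑) : ‖chi A‖ ≤ 1 := (isStarProjection_chi A).norm_le

/-- The `{0,1}`-valued homomorphisms on `𝓑` are evaluations at points of the spectrum, or zero. -/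
theorem exists_character (p : 𝓑 → ℂ) (hbot : p ⊥ = 0) (hinf : ∀ A B, p (A ⊓ B) = p A * p B)
    (hsup : ∀ A B, p (A ⊔ B) = p A + p B - p (A ⊓ B)) :
    ∃ ψ : FunctionAlg 𝓑 →⋆ₙₐ[ℂ] ℂ, (∀ A, ψ (chi A) = p A) ∧ ∀ f, ‖ψ f‖ ≤ ‖f‖ := by
  classical
  have h01 : ∀ A, p A = 0 ∨ p A = 1 := fun A => by
    have h : p A * p A = p A := by rw [← hinf, inf_idem]
    rcases eq_or_ne (p A) 0 with h0 | h0
    · exact Or.inl h0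
    · exact Or.inr (mul_right_cancel₀ h0 (by rw [h, one_mul]))
  -- An ultrafilter must be non-empty, so the homomorphism that vanishes identically is split off;
  -- it corresponds to the zero character.
  by_cases hne : ∃ A, p A = 1
  · let ξ : BoolSpectrum 𝓑 :=
      { carrier := {A | p A = 1}
        nonempty := hne
        bot_notMem := by simp [hbot]
        mem_of_le := fun {A B} hA hAB => by
          have h := hinf A B
          rw [inf_eq_left.2 hAB, show p A = 1 from hA, one_mul] at h
          exact h.symm
        inf_mem := fun {A B} hA hB => by
          rw [Set.mem_ofPred_eq, hinf, show p A = 1 from hA, show p B = 1 from hB, one_mul]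
        mem_or_mem := fun {A B} hAB => by
          rw [Set.mem_ofPred_eq, hsup, hinf] at hAB
          rcases h01 A with h | h
          · exact Or.inr (by simpa [h] using hAB)
          · exact Or.inl h }
    refine ⟨eval ξ, fun A => ?_, norm_eval_le ξ⟩
    rw [eval_chi]
    split_ifs with h
    · exact (show p A = 1 from h).symm
    · exact ((h01 A).resolve_right h).symm
  · refine ⟨0, fun A => ((h01 A).resolve_right fun h => hne ⟨A, h⟩).symm, by simp⟩

/-- Each character `φ` of `S` composed with `P` comes from a contractive character `ψ` of `𝒜(𝓑)`. On
the `*`-algebra generated by the pairs `(χ_A, P A)` the two agree, so `|φ(p.2)| = |ψ(p.1)| ≤ ‖p.1‖`;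
since characters compute the norm of `S`, this algebra is the graph of a contraction. -/
theorem exists_starHom_of_comm {S : Type*} [NonUnitalCommCStarAlgebra S] (P : 𝓑 → S)
    (hbot : P ⊥ = 0) (hinf : ∀ A B, P (A ⊓ B) = P A * P B)
    (hsup : ∀ A B, P (A ⊔ B) = P A + P B - P (A ⊓ B)) :
    ∃ π : FunctionAlg 𝓑 →⋆ₙₐ[ℂ] S, ∀ A, π (chi A) = P A := by
  set s : Set (FunctionAlg 𝓑 × S) := Set.range fun A => (chi A, P A)
  have hchar : ∀ p ∈ NonUnitalStarAlgebra.adjoin ℂ s, ∀ (φ : S →⋆ₙₐ[ℂ] ℂ)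
      (ψ : FunctionAlg 𝓑 →⋆ₙₐ[ℂ] ℂ), (∀ A, ψ (chi A) = φ (P A)) → φ p.2 = ψ p.1 := by
    intro p hp φ ψ h
    induction hp using NonUnitalStarAlgebra.adjoin_induction with
    | mem p h' =>
      obtain ⟨A, rfl⟩ := h'
      exact (h A).symm
    | zero => simp
    | add p q _ _ hp hq => simp [hp, hq]
    | mul p q _ _ hp hq => simp [hp, hq]
    | smul c p _ hp => simp [hp]
    | star p _ hp => rw [Prod.snd_star, Prod.fst_star, map_star, map_star, hp]
  obtain ⟨π, hπ⟩ := (NonUnitalStarAlgebra.adjoin ℂ s).exists_starHom_of_graph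
    (fun p hp => by
      refine norm_le_of_forall_character (norm_nonneg _) fun φ => ?_
      obtain ⟨ψ, hψ, hn⟩ := exists_character (fun A => φ (P A)) (by simp [hbot])
        (fun A B => by simp [hinf]) (fun A B => by simp [hsup])
      rw [hchar p hp φ ψ hψ]
      exact hn p.1)
    (fun f => by
      refine closure_mono ?_ (mem_closure_span_chi f)
      intro g hg
      induction hg using Submodule.span_induction with
      | mem _ h =>
        obtain ⟨A, rfl⟩ := h
        exact ⟨(chi A, P A), NonUnitalStarAlgebra.subset_adjoin ℂ s ⟨A, rfl⟩, rfl⟩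
      | zero => exact ⟨0, zero_mem _, rfl⟩
      | add x y _ _ hx hy =>
        obtain ⟨p, hp, rfl⟩ := hx
        obtain ⟨q, hq, rfl⟩ := hy
        exact ⟨p + q, add_mem hp hq, rfl⟩
      | smul c x _ hx =>
        obtain ⟨p, hp, rfl⟩ := hx
        exact ⟨c • p, SMulMemClass.smul_mem c hp, rfl⟩)
  exact ⟨π, fun A => hπ (chi A, P A) (NonUnitalStarAlgebra.subset_adjoin ℂ s ⟨A, rfl⟩)⟩

open scoped IsMulCommutative in
open NonUnitalStarAlgebra NonUnitalStarSubalgebra in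
/-- A representation of `𝓑` by projections extends to a `*`-homomorphism on `𝒜(𝓑)`. -/
theorem exists_starHom (P : 𝓑 → 𝒳) (hP : ∀ A, IsStarProjection (P A)) (hbot : P ⊥ = 0)
    (hinf : ∀ A B, P (A ⊓ B) = P A * P B) (hsup : ∀ A B, P (A ⊔ B) = P A + P B - P (A ⊓ B)) :
    ∃ π : FunctionAlg 𝓑 →⋆ₙₐ[ℂ] 𝒳, ∀ A, π (chi A) = P A := by
  have hcomm : ∀ A B, P A * P B = P B * P A := fun A B => by rw [← hinf, ← hinf, inf_comm]
  have hstar : ∀ A, star (P A) = P A := fun A => (hP A).isSelfAdjoint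
  let S : NonUnitalStarSubalgebra ℂ 𝒳 := (adjoin ℂ (Set.range P)).topologicalClosure
  have hS : IsClosed (S : Set 𝒳) := (adjoin ℂ (Set.range P)).isClosed_topologicalClosure
  -- The `P A` are self-adjoint and commute because `⊓` does, so the closed algebra they generate is
  -- commutative and the previous case applies to it.
  have : IsMulCommutative (adjoin ℂ (Set.range P)) :=
    isMulCommutative_adjoin ℂ (by rintro _ ⟨A, rfl⟩ _ ⟨B, rfl⟩; exact hcomm A B)
      (by rintro _ ⟨A, rfl⟩ _ ⟨B, rfl⟩; rw [hstar]; exact hcomm A B)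
  let _ : NonUnitalCommRing S :=
    (adjoin ℂ (Set.range P)).nonUnitalCommRingTopologicalClosure mul_comm
  let _ : NonUnitalCommCStarAlgebra S := { }
  have hmem : ∀ A, P A ∈ S := fun A =>
    le_topologicalClosure _ (subset_adjoin ℂ _ ⟨A, rfl⟩)
  obtain ⟨π, hπ⟩ := exists_starHom_of_comm (S := S) (fun A => ⟨P A, hmem A⟩) (Subtype.ext hbot)
    (fun A B => Subtype.ext (hinf A B)) (fun A B => Subtype.ext (hsup A B))
  exact ⟨(NonUnitalStarSubalgebraClass.subtype S).comp π, fun A => congrArg Subtype.val (hπ A)⟩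

end FunctionAlg

/-! ### The vectors `e_{α,A}` and their dense span in `X` -/

namespace GenBoolDynSystem

open FunctionAlg

variable {𝓑 𝓛 : Type*} [GeneralizedBooleanAlgebra 𝓑] {D : GenBoolDynSystem 𝓑 𝓛}

namespace HilbertMod

open Classical in
theorem coord_e (α β : 𝓛) (A : D.I α) :
    (e α A).coord β = if α = β then chi (A : 𝓑) else 0 := rfl

theorem inner_e_left (α : 𝓛) (A : D.I α) (x : D.HilbertMod) :
    inner (FunctionAlg 𝓑) (e α A) x = chi (A : 𝓑) * x.coord α := by
  rw [inner_def, tsum_eq_single α]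
  · rw [coord_e, if_pos rfl, star_chi]
  · intro β hβ
    rw [coord_e, if_neg hβ.symm, star_zero, zero_mul]

open Classical in
theorem inner_e_e (α β : 𝓛) (A : D.I α) (B : D.I β) :
    inner (FunctionAlg 𝓑) (e α A) (e β B) = if α = β then chi ((A : 𝓑) ⊓ (B : 𝓑)) else 0 := by
  rw [inner_e_left, coord_e]
  by_cases h : α = β
  · rw [if_pos h.symm, if_pos h, chi_mul_chi]
  · rw [if_neg (Ne.symm h), if_neg h, mul_zero]

theorem inner_add_left (x y z : D.HilbertMod) : inner (FunctionAlg 𝓑) (x + y) z =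
    inner (FunctionAlg 𝓑) x z + inner (FunctionAlg 𝓑) y z :=
  CStarModule.inner_add_left (A := FunctionAlg 𝓑) (E := D.HilbertMod)

theorem inner_add_right (x y z : D.HilbertMod) : inner (FunctionAlg 𝓑) x (y + z) =
    inner (FunctionAlg 𝓑) x y + inner (FunctionAlg 𝓑) x z :=
  CStarModule.inner_add_right (A := FunctionAlg 𝓑) (E := D.HilbertMod)

theorem inner_smul_left (c : ℂ) (x y : D.HilbertMod) : inner (FunctionAlg 𝓑) (c • x) y =
    star c • inner (FunctionAlg 𝓑) x y :=
  CStarModule.inner_smul_left_complex (A := FunctionAlg 𝓑) (E := D.HilbertMod)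

theorem inner_smul_right (c : ℂ) (x y : D.HilbertMod) : inner (FunctionAlg 𝓑) x (c • y) =
    c • inner (FunctionAlg 𝓑) x y :=
  CStarModule.inner_smul_right_complex (A := FunctionAlg 𝓑) (E := D.HilbertMod)

theorem inner_zero_left (x : D.HilbertMod) : inner (FunctionAlg 𝓑) 0 x = 0 :=
  CStarModule.inner_zero_left (A := FunctionAlg 𝓑) (E := D.HilbertMod)

theorem inner_zero_right (x : D.HilbertMod) : inner (FunctionAlg 𝓑) x 0 = 0 :=
  CStarModule.inner_zero_right (A := FunctionAlg 𝓑) (E := D.HilbertMod)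

theorem continuous_inner_left (y : D.HilbertMod) :
    Continuous fun x => inner (FunctionAlg 𝓑) x y :=
  CStarCorrespondence.continuous_inner_left (A := FunctionAlg 𝓑) (X := D.HilbertMod) y

theorem continuous_inner_right (x : D.HilbertMod) :
    Continuous fun y => inner (FunctionAlg 𝓑) x y :=
  CStarCorrespondence.continuous_inner_right (A := FunctionAlg 𝓑) (X := D.HilbertMod) x

theorem φ_apply_coord (f : FunctionAlg 𝓑) (x : D.HilbertMod) (α : 𝓛) :
    (D.correspondence.φ f x).coord α = pull (D.isBoolAction α) f * x.coord α := rfl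

theorem φ_apply_e (f : FunctionAlg 𝓑) (α : 𝓛) (A : D.I α) :
    D.correspondence.φ f (e α A) = pull (D.isBoolAction α) f • e α A :=
  ext_coord fun β => by
    rw [φ_apply_coord, coord_action, coord_e]
    split_ifs with h
    · subst h; rw [mul_comm]
    · simp

theorem norm_coord_le (x : D.HilbertMod) (α : 𝓛) : ‖x.coord α‖ ≤ ‖x‖ := by
  refine le_of_sq_le_sq ?_ (norm_nonneg _)
  rw [CStarModule.norm_sq_eq (FunctionAlg 𝓑) (x := x), sq, ← CStarRing.norm_star_mul_self]
  refine CStarAlgebra.norm_le_norm_of_nonneg_of_le (star_mul_self_nonneg _) ?_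
  exact (x.summable_coord x).le_tsum α fun β _ => star_mul_self_nonneg _

theorem norm_e_le (α : 𝓛) (A : D.I α) : ‖(e α A : D.HilbertMod)‖ ≤ 1 := by
  refine le_of_sq_le_sq ?_ zero_le_one
  rw [CStarModule.norm_sq_eq (FunctionAlg 𝓑), inner_e_e, if_pos rfl, one_pow]
  exact norm_chi_le _

open Classical in
/-- The element of `X` with one prescribed coordinate, all others being zero. -/
noncomputable def single (α : 𝓛) : chiSpan (D.I α : Set 𝓑) →ₗ[ℂ] D.HilbertMod where
  toFun f := (⟨fun β => if α = β then (f : FunctionAlg 𝓑) else 0, fun β => by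
      dsimp only
      split_ifs with h
      · subst h; exact f.2
      · exact zero_mem _, by
      refine summable_of_ne_finset_zero (s := {α}) fun β hβ => ?_
      have h : α ≠ β := by simpa [eq_comm] using hβ
      simp [h]⟩ : D.moduleCarrier)
  map_add' f g := ext_coord fun β => by
    change (if α = β then ((f + g : chiSpan _) : FunctionAlg 𝓑) else 0) =
      (if α = β then (f : FunctionAlg 𝓑) else 0) + if α = β then (g : FunctionAlg 𝓑) else 0
    split_ifs <;> simp
  map_smul' c f := ext_coord fun β => by
    change (if α = β then ((c • f : chiSpan _) : FunctionAlg 𝓑) else 0) =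
      c • if α = β then (f : FunctionAlg 𝓑) else 0
    split_ifs <;> simp

open Classical in
theorem coord_single (α β : 𝓛) (f : chiSpan (D.I α : Set 𝓑)) :
    (single α f : D.HilbertMod).coord β = if α = β then (f : FunctionAlg 𝓑) else 0 := rfl

theorem norm_single_le (α : 𝓛) (f : chiSpan (D.I α : Set 𝓑)) :
    ‖(single α f : D.HilbertMod)‖ ≤ ‖f‖ := by
  refine le_of_sq_le_sq ?_ (norm_nonneg _)
  rw [CStarModule.norm_sq_eq (FunctionAlg 𝓑), inner_def, tsum_eq_single α]
  · rw [coord_single, if_pos rfl, CStarRing.norm_star_mul_self, sq]; rfl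
  · intro β hβ
    rw [coord_single, if_neg hβ.symm, mul_zero]

theorem continuous_single (α : 𝓛) :
    Continuous (single α : chiSpan (D.I α : Set 𝓑) → D.HilbertMod) :=
  AddMonoidHomClass.continuous_of_bound (single α) 1 fun f => by
    simpa using norm_single_le α f

/-- The linear span of the elements `e_{α,A}`. -/
noncomputable def spanE (D : GenBoolDynSystem 𝓑 𝓛) : Submodule ℂ D.HilbertMod :=
  Submodule.span ℂ (Set.range fun p : Σ α, D.I α => e p.1 p.2)

theorem single_mem_closure_spanE (α : 𝓛) (f : chiSpan (D.I α : Set 𝓑)) :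
    single α f ∈ (spanE D).topologicalClosure := by
  have hc : IsClosed (single α ⁻¹' ((spanE D).topologicalClosure : Set D.HilbertMod)) :=
    (Submodule.isClosed_topologicalClosure _).preimage (continuous_single α)
  have hd : f ∈ closure {g : chiSpan (D.I α : Set 𝓑) |
      (g : FunctionAlg 𝓑) ∈ Submodule.span ℂ (chi '' (D.I α : Set 𝓑))} := by
    rw [Topology.IsInducing.subtypeVal.closure_eq_preimage_closure_image]
    refine closure_mono ?_ (show (f : FunctionAlg 𝓑) ∈ closure _ from f.2)
    exact fun g hg => ⟨⟨g, Submodule.le_topologicalClosure _ hg⟩, hg, rfl⟩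
  refine closure_minimal ?_ hc hd
  rintro ⟨g, hg'⟩ hg
  rw [Set.mem_ofPred_eq] at hg
  change single α _ ∈ (spanE D).topologicalClosure
  dsimp only at hg
  induction hg using Submodule.span_induction with
  | mem g h =>
    obtain ⟨A, hA, rfl⟩ := h
    exact Submodule.le_topologicalClosure _ (Submodule.subset_span ⟨⟨α, A, hA⟩, rfl⟩)
  | zero =>
    rw [show (⟨0, hg'⟩ : chiSpan (D.I α : Set 𝓑)) = 0 from rfl, map_zero]
    exact zero_mem _
  | add x y hx hy ihx ihy =>
    have hx' := Submodule.le_topologicalClosure _ hx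
    have hy' := Submodule.le_topologicalClosure _ hy
    rw [show (⟨x + y, hg'⟩ : chiSpan (D.I α : Set 𝓑)) = ⟨x, hx'⟩ + ⟨y, hy'⟩ from rfl, map_add]
    exact add_mem (ihx hx') (ihy hy')
  | smul c x hx ihx =>
    have hx' := Submodule.le_topologicalClosure _ hx
    rw [show (⟨c • x, hg'⟩ : chiSpan (D.I α : Set 𝓑)) = c • ⟨x, hx'⟩ from rfl, map_smul]
    exact Submodule.smul_mem _ c (ihx hx')

theorem coord_sum_single (x : D.HilbertMod) (F : Finset 𝓛) (β : 𝓛) [Decidable (β ∈ F)] :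
    (∑ α ∈ F, single α ⟨x.coord α, x.coord_mem α⟩ : D.HilbertMod).coord β =
      if β ∈ F then x.coord β else 0 := by
  classical
  have h : ∀ F : Finset 𝓛,
      (∑ α ∈ F, single α ⟨x.coord α, x.coord_mem α⟩ : D.HilbertMod).coord β =
        ∑ α ∈ F, (single α ⟨x.coord α, x.coord_mem α⟩ : D.HilbertMod).coord β := by
    intro F
    induction F using Finset.induction_on with
    | empty => rfl
    | insert a F ha ih => rw [Finset.sum_insert ha, Finset.sum_insert ha, coord_add, ih]
  rw [h]
  simp only [coord_single]
  rw [Finset.sum_ite_eq' F β x.coord]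
  congr

/-- The squared norm of the remainder outside a finite set `F` is the norm of the tail of `∑ x_α^*
x_α`, which tends to zero by the very definition of `X`. -/
theorem hasSum_single (x : D.HilbertMod) :
    HasSum (fun α => single α ⟨x.coord α, x.coord_mem α⟩) x := by
  classical
  rw [HasSum, SummationFilter.unconditional_filter, tendsto_iff_norm_sub_tendsto_zero]
  have hs := (x.summable_coord x).hasSum
  rw [HasSum, SummationFilter.unconditional_filter, tendsto_iff_norm_sub_tendsto_zero] at hs
  have hs' := (Real.continuous_sqrt.tendsto 0).comp hs
  rw [Real.sqrt_zero] at hs'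
  refine hs'.congr fun F => ?_
  rw [Function.comp_apply]
  set y : D.HilbertMod := ∑ α ∈ F, single α ⟨x.coord α, x.coord_mem α⟩ with hy
  have hc : ∀ α, (y - x).coord α = (if α ∈ F then x.coord α else 0) - x.coord α := fun α => by
    rw [← coord_sum_single x F α]; rfl
  rw [← Real.sqrt_sq (norm_nonneg (y - x)), CStarModule.norm_sq_eq (FunctionAlg 𝓑), inner_def,
    norm_sub_rev]
  congr 2
  have h1 : HasSum (fun α => if α ∈ F then star (x.coord α) * x.coord α else 0)
      (∑ α ∈ F, star (x.coord α) * x.coord α) := by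
    have := hasSum_sum_of_ne_finset_zero (s := F) (L := .unconditional 𝓛)
      (f := fun α => if α ∈ F then star (x.coord α) * x.coord α else 0)
      fun α hα => if_neg hα
    rwa [Finset.sum_congr rfl fun α hα => if_pos hα] at this
  have h2 := ((x.summable_coord x).hasSum.sub h1).tsum_eq
  rw [← h2]
  refine tsum_congr fun α => ?_
  rw [hc]
  split_ifs <;> simp

theorem mem_closure_spanE (x : D.HilbertMod) : x ∈ (spanE D).topologicalClosure := by
  refine (Submodule.isClosed_topologicalClosure (spanE D)).mem_of_tendsto (hasSum_single x)
    (Filter.Eventually.of_forall fun F => ?_)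
  exact Submodule.sum_mem _ fun α _ => single_mem_closure_spanE α _

/-- A closed property that is compatible with linear combinations holds on `X` if it holds for the
elements `e_{α,A}`. -/
theorem induction_e {p : D.HilbertMod → Prop} (hp : IsClosed {x | p x})
    (e : ∀ α (A : D.I α), p (e α A)) (zero : p 0) (add : ∀ x y, p x → p y → p (x + y))
    (smul : ∀ (c : ℂ) x, p x → p (c • x)) (x : D.HilbertMod) : p x := by
  refine closure_minimal (fun x hx => ?_) hp (mem_closure_spanE x)
  rw [Set.mem_ofPred_eq]
  induction hx using Submodule.span_induction with
  | mem _ h =>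
    obtain ⟨⟨α, A⟩, rfl⟩ := h
    exact e α A
  | zero => exact zero
  | add x y _ _ hx hy => exact add x y hx hy
  | smul c x _ hx => exact smul c x hx

end HilbertMod

end GenBoolDynSystem

/-! ### From representations of the system to representations of the correspondence and back -/

namespace GenBoolDynSystem

open FunctionAlg HilbertMod

variable {𝓑 𝓛 : Type*} [GeneralizedBooleanAlgebra 𝓑] {D : GenBoolDynSystem 𝓑 𝓛}
  {𝒳 : Type*} [NonUnitalCStarAlgebra 𝒳]

namespace Rep

variable {J : Set 𝓑} (R : D.Rep J 𝒳)

/-- By sesquilinearity only generators matter, and there relation (iii) is the formula for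
`⟨e_{α,A}, e_{β,B}⟩`. The case `p = q` bounds `‖p.2‖` by `‖p.1‖`, which is what lets `e_{α,A} ↦
S_{α,A}` extend to `X`. -/
theorem star_mul_of_mem_span {π : FunctionAlg 𝓑 →⋆ₙₐ[ℂ] 𝒳} (hπ : ∀ A, π (chi A) = R.P A)
    {p q : D.HilbertMod × 𝒳}
    (hp : p ∈ Submodule.span ℂ (Set.range fun i : Σ α, D.I α => (e i.1 i.2, R.S i.1 i.2)))
    (hq : q ∈ Submodule.span ℂ (Set.range fun i : Σ α, D.I α => (e i.1 i.2, R.S i.1 i.2))) :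
    star p.2 * q.2 = π (inner (FunctionAlg 𝓑) p.1 q.1) := by
  classical
  induction hp using Submodule.span_induction with
  | mem p h =>
    obtain ⟨⟨α, A⟩, rfl⟩ := h
    induction hq using Submodule.span_induction with
    | mem q h =>
      obtain ⟨⟨β, B⟩, rfl⟩ := h
      dsimp only
      rw [R.star_S_mul_S, inner_e_e]
      split_ifs
      · rw [hπ]
      · rw [map_zero]
    | zero =>
      change _ * (0 : 𝒳) = π (inner (FunctionAlg 𝓑) _ (0 : D.HilbertMod))
      rw [mul_zero, HilbertMod.inner_zero_right, map_zero]
    | add p q _ _ hp hq =>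
      change _ * (p.2 + q.2) = π (inner (FunctionAlg 𝓑) _ (p.1 + q.1))
      rw [mul_add, HilbertMod.inner_add_right, map_add, hp, hq]
    | smul c p _ hp =>
      change _ * (c • p.2) = π (inner (FunctionAlg 𝓑) _ (c • p.1))
      rw [mul_smul_comm, HilbertMod.inner_smul_right, map_smul, hp]
  | zero =>
    change star (0 : 𝒳) * _ = π (inner (FunctionAlg 𝓑) (0 : D.HilbertMod) _)
    rw [star_zero, zero_mul, HilbertMod.inner_zero_left, map_zero]
  | add p q _ _ hp hq =>
    change star (p.2 + q.2) * _ = π (inner (FunctionAlg 𝓑) (p.1 + q.1) _)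
    rw [star_add, add_mul, HilbertMod.inner_add_left, map_add, hp, hq]
  | smul c p _ hp =>
    change star (c • p.2) * _ = π (inner (FunctionAlg 𝓑) (c • p.1) _)
    rw [star_smul, smul_mul_assoc, HilbertMod.inner_smul_left, map_smul, hp]

/-- Every representation of a generalized Boolean dynamical system extends to a representation of
its correspondence. -/
theorem exists_corrRep : ∃ ρ : D.correspondence.Rep 𝒳,
    (∀ A, ρ.π (chi A) = R.P A) ∧ ∀ α B, ρ.t (e α B) = R.S α B := by
  obtain ⟨π, hπ⟩ := exists_starHom R.P R.isStarProjection_P R.P_bot R.P_inf R.P_sup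
  have hd : ∀ x : D.HilbertMod, x ∈ closure (Prod.fst '' (Submodule.span ℂ (Set.range
      fun i : Σ α, D.I α => (e i.1 i.2, R.S i.1 i.2)) : Set (D.HilbertMod × 𝒳))) := by
    intro x
    refine closure_mono ?_ (mem_closure_spanE x)
    have hle : spanE D ≤ (Submodule.span ℂ (Set.range fun i : Σ α, D.I α =>
        ((e i.1 i.2 : D.HilbertMod), R.S i.1 i.2))).map (LinearMap.fst ℂ D.HilbertMod 𝒳) := by
      rw [Submodule.map_span, ← Set.range_comp]
      exact le_rfl
    exact fun y hy => hle hy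
  obtain ⟨t, ht, -⟩ := Submodule.exists_clm_of_graph (C := 1) _ (fun p hp => by
    rw [one_mul]
    refine le_of_sq_le_sq ?_ (norm_nonneg _)
    rw [sq, ← CStarRing.norm_star_mul_self, R.star_mul_of_mem_span hπ hp hp,
      CStarModule.norm_sq_eq (FunctionAlg 𝓑)]
    exact NonUnitalStarAlgHom.norm_apply_le π _) hd
  have hte : ∀ α B, t (e α B) = R.S α B := fun α B =>
    ht (e α B, R.S α B) (Submodule.subset_span ⟨⟨α, B⟩, rfl⟩)
  have hπc := continuous_starHom π
  have hstar : ∀ x y, star (t x) * t y = π (inner (FunctionAlg 𝓑) x y) := by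
    classical
    intro x y
    induction x using induction_e with
    | hp => exact isClosed_eq (by fun_prop) (hπc.comp (continuous_inner_left y))
    | zero => rw [map_zero, star_zero, zero_mul, HilbertMod.inner_zero_left, map_zero]
    | add x z hx hz => rw [map_add, star_add, add_mul, HilbertMod.inner_add_left, map_add, hx, hz]
    | smul c x hx =>
      rw [map_smul, star_smul, smul_mul_assoc, HilbertMod.inner_smul_left, map_smul, hx]
    | e α A =>
      induction y using induction_e with
      | hp => exact isClosed_eq (by fun_prop) (hπc.comp (continuous_inner_right _))
      | zero => rw [map_zero, mul_zero, HilbertMod.inner_zero_right, map_zero]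
      | add x z hx hz => rw [map_add, mul_add, HilbertMod.inner_add_right, map_add, hx, hz]
      | smul c x hx =>
        rw [map_smul, mul_smul_comm, HilbertMod.inner_smul_right, map_smul, hx]
      | e β B =>
        rw [hte, hte, R.star_S_mul_S, inner_e_e]
        split_ifs
        · rw [hπ]
        · rw [map_zero]
  have hmul : ∀ f x, π f * t x = t (D.correspondence.φ f x) := by
    intro f x
    induction x using induction_e with
    | hp => exact isClosed_eq (by fun_prop) (by fun_prop)
    | zero => simp
    | add x z hx hz => simp only [map_add, mul_add, hx, hz]
    | smul c x hx => simp only [map_smul, mul_smul_comm, hx]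
    | e α B =>
      -- On `e_{α,B}` the left action of `f` is the right action of `φ_α(f)`, so for `f = χ_A` the
      -- claim is relation (ii).
      rw [φ_apply_e, ← CStarCorrespondence.mul_eq_of_star_mul_eq hstar]
      induction f using induction_chi with
      | hp =>
        have := continuous_starHom (pull (D.isBoolAction α))
        exact isClosed_eq (by fun_prop) (by fun_prop)
      | chi A => rw [hπ, pull_chi, hπ, hte, R.P_mul_S]
      | zero => simp
      | add f g hf hg => simp only [map_add, add_mul, mul_add, hf, hg]
      | smul c f hf => simp only [map_smul, smul_mul_assoc, mul_smul_comm, hf]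
  exact ⟨⟨π, t, hstar, hmul⟩, hπ, hte⟩

open Classical in
/-- The representation of a generalized Boolean dynamical system given by a representation of its
correspondence. -/
noncomputable def ofCorr (ρ : D.correspondence.Rep 𝒳) (J : Set 𝓑)
    (h : ∀ A ∈ J, ρ.π (chi A) = ∑ᶠ α ∈ D.Δ A,
      ρ.t (e α ⟨D.θ α A, D.mem_I α A⟩) * star (ρ.t (e α ⟨D.θ α A, D.mem_I α A⟩))) :
    D.Rep J 𝒳 where
  P A := ρ.π (chi A)
  S α B := ρ.t (e α B)
  isStarProjection_P A := (isStarProjection_chi A).map ρ.π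
  partialIsometry_S α B := by
    -- This turns `t(e) t(e)^* t(e)` into `t(e · χ_B)`, and `e_{α,B} · χ_B = e_{α,B}`.
    rw [mul_assoc, ρ.star_t_mul_t, inner_e_e, if_pos rfl, inf_idem, ρ.t_mul_π]
    congr 1
    refine ext_coord fun β => ?_
    rw [coord_action, coord_e]
    split_ifs
    · rw [chi_mul_chi, inf_idem]
    · rw [zero_mul]
  P_bot := by rw [chi_bot, map_zero]
  P_inf A A' := by rw [← chi_mul_chi, map_mul]
  P_sup A A' := by rw [chi_sup, map_sub, map_add]
  P_mul_S A α B := by rw [ρ.π_mul_t, φ_apply_e, pull_chi, ρ.t_mul_π]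
  star_S_mul_S α α' B B' := by
    rw [ρ.star_t_mul_t, inner_e_e, apply_ite ρ.π, map_zero]
  P_eq_sum := h

end Rep

/-- Two representations of the correspondence that agree on the generators are equal. -/
theorem corrRep_ext {ρ σ : D.correspondence.Rep 𝒳} (hπ : ∀ A, ρ.π (chi A) = σ.π (chi A))
    (ht : ∀ α B, ρ.t (e α B) = σ.t (e α B)) : (∀ f, ρ.π f = σ.π f) ∧ ∀ x, ρ.t x = σ.t x := by
  refine ⟨fun f => DFunLike.congr_fun (starHom_ext hπ) f, fun x => ?_⟩
  induction x using induction_e with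
  | hp => exact isClosed_eq ρ.continuous_t σ.continuous_t
  | e α A => exact ht α A
  | zero => simp
  | add x y hx hy => simp [hx, hy]
  | smul c x hx => simp [hx]

/-- The left action of `χ_A` is a sum of rank-one operators if `Δ_A` is finite. -/
theorem φ_chi_eq_sum {A : 𝓑} (hA : (D.Δ A).Finite) : D.correspondence.φ (chi A) =
    ∑ α ∈ hA.toFinset, CStarCorrespondence.Θ (FunctionAlg 𝓑)
      (e α ⟨D.θ α A, D.mem_I α A⟩) (e α ⟨D.θ α A, D.mem_I α A⟩ : D.HilbertMod) := by
  classical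
  refine ContinuousLinearMap.ext fun x => ext_coord fun β => ?_
  have hsum : ∀ (F : Finset 𝓛) (y : 𝓛 → D.HilbertMod),
      (∑ α ∈ F, y α).coord β = ∑ α ∈ F, (y α).coord β := by
    intro F y
    induction F using Finset.induction_on with
    | empty => rfl
    | insert a F ha ih => rw [Finset.sum_insert ha, Finset.sum_insert ha, coord_add, ih]
  rw [sum_apply, hsum, φ_apply_coord, pull_chi]
  have h : ∀ α, (CStarCorrespondence.Θ (FunctionAlg 𝓑) (e α ⟨D.θ α A, D.mem_I α A⟩)
      (e α ⟨D.θ α A, D.mem_I α A⟩ : D.HilbertMod) x).coord β =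
      if α = β then chi (D.θ α A) * x.coord α else 0 := by
    intro α
    rw [CStarCorrespondence.Θ_apply, coord_action, coord_e, inner_e_left]
    split_ifs
    · rw [← mul_assoc, chi_mul_chi, inf_idem]
    · rw [zero_mul]
  simp only [h]
  rw [Finset.sum_ite_eq' hA.toFinset β fun α => chi (D.θ α A) * x.coord α]
  split_ifs with hβ
  · rfl
  -- Outside `Δ_A` the left action of `χ_A` vanishes as well.
  · have hb : D.θ β A = ⊥ := by simpa [Δ] using hβ
    rw [hb, chi_bot, zero_mul]

theorem finite_Δ_of_mem_reg {A : 𝓑} (hA : A ∈ D.reg) : (D.Δ A).Finite := by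
  by_cases h : A = ⊥
  · subst h
    simp [Δ, (D.isBoolAction _).map_bot]
  · exact (hA A le_rfl h).2

theorem φ_chi_mem_compacts {A : 𝓑} (hA : A ∈ D.reg) : D.correspondence.φ (chi A) ∈
    CStarCorrespondence.compacts (FunctionAlg 𝓑) D.HilbertMod := by
  rw [φ_chi_eq_sum (finite_Δ_of_mem_reg hA)]
  exact Submodule.sum_mem _ fun α _ => CStarCorrespondence.Θ_mem_compacts _ _

theorem compactsMap_φ_chi {ψ : CStarCorrespondence.compacts (FunctionAlg 𝓑) D.HilbertMod →L[ℂ] 𝒳}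
    {ρ : D.correspondence.Rep 𝒳}
    (hψ : ∀ x y, ψ ⟨CStarCorrespondence.Θ (FunctionAlg 𝓑) x y,
      CStarCorrespondence.Θ_mem_compacts x y⟩ = ρ.t x * star (ρ.t y)) {A : 𝓑} (hA : A ∈ D.reg) :
    ψ ⟨D.correspondence.φ (chi A), φ_chi_mem_compacts hA⟩ = ∑ᶠ α ∈ D.Δ A,
      ρ.t (e α ⟨D.θ α A, D.mem_I α A⟩) * star (ρ.t (e α ⟨D.θ α A, D.mem_I α A⟩)) := by
  rw [finsum_mem_eq_finite_toFinset_sum _ (finite_Δ_of_mem_reg hA)]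
  simp only [← hψ]
  rw [← map_sum]
  congr 1
  refine Subtype.ext ?_
  rw [Submodule.coe_sum]
  exact φ_chi_eq_sum (finite_Δ_of_mem_reg hA)

theorem norm_φ_le (f : FunctionAlg 𝓑) : ‖D.correspondence.φ f‖ ≤ ‖f‖ :=
  LinearMap.mkContinuous_norm_le _ (norm_nonneg f) (norm_leftFun_le f)

theorem continuous_φ : Continuous D.correspondence.φ :=
  AddMonoidHomClass.continuous_of_bound D.correspondence.φ 1 fun f => by
    simpa using norm_φ_le f

open CStarCorrespondence in
/-- Relation (iv) for the regular elements is coisometricity on the closed span of their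
indicator functions. -/
theorem isCoisometric_closure_iff (ρ : D.correspondence.Rep 𝒳) :
    ρ.IsCoisometric (closure (Submodule.span ℂ (chi '' D.reg) : Set (FunctionAlg 𝓑))) ↔
      ∀ A ∈ D.reg, ρ.π (chi A) = ∑ᶠ α ∈ D.Δ A,
        ρ.t (e α ⟨D.θ α A, D.mem_I α A⟩) * star (ρ.t (e α ⟨D.θ α A, D.mem_I α A⟩)) := by
  constructor
  · rintro ⟨ψ, hψ, h⟩ A hA
    obtain ⟨_, hf⟩ := h (chi A) (subset_closure (Submodule.subset_span ⟨A, hA, rfl⟩))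
    rw [hf, compactsMap_φ_chi hψ hA]
  · intro h
    obtain ⟨ψ, hψ⟩ := ρ.exists_compactsMap
    refine ⟨ψ, hψ, fun f hf => ?_⟩
    have hK : IsClosed (compacts (FunctionAlg 𝓑) D.HilbertMod : Set (D.HilbertMod →L[ℂ] D.HilbertMod)) :=
      Submodule.isClosed_topologicalClosure _
    let V : Submodule ℂ (FunctionAlg 𝓑) :=
      (compacts (FunctionAlg 𝓑) D.HilbertMod).comap (D.correspondence.φ : _ →ₗ[ℂ] _)
    have hV : ∀ f ∈ closure (Submodule.span ℂ (chi '' D.reg) : Set (FunctionAlg 𝓑)),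
        f ∈ V := by
      refine closure_minimal ?_ (hK.preimage continuous_φ)
      refine Submodule.span_le.2 ?_
      rintro _ ⟨A, hA, rfl⟩
      exact φ_chi_mem_compacts hA
    refine ⟨hV f hf, ?_⟩
    -- Since `ψ` takes its argument together with a proof of compactness, the density argument is
    -- run on the closed span as a subtype, where `f ↦ ψ(φ(f))` is a genuine continuous function.
    let g : (Submodule.span ℂ (chi '' D.reg)).topologicalClosure →
        compacts (FunctionAlg 𝓑) D.HilbertMod := fun f => ⟨D.correspondence.φ f, hV f f.2⟩
    have hg : Continuous g := (continuous_φ.comp continuous_subtype_val).subtype_mk _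
    have hcl : IsClosed {f : (Submodule.span ℂ (chi '' D.reg)).topologicalClosure |
        ρ.π f = ψ (g f)} :=
      isClosed_eq (ρ.continuous_π.comp continuous_subtype_val) (ψ.continuous.comp hg)
    have hd : (⟨f, hf⟩ : (Submodule.span ℂ (chi '' D.reg)).topologicalClosure) ∈
        closure {f : (Submodule.span ℂ (chi '' D.reg)).topologicalClosure |
          (f : FunctionAlg 𝓑) ∈ Submodule.span ℂ (chi '' D.reg)} := by
      rw [Topology.IsInducing.subtypeVal.closure_eq_preimage_closure_image]
      refine closure_mono ?_ (show f ∈ closure _ from hf)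
      exact fun f hf => ⟨⟨f, Submodule.le_topologicalClosure _ hf⟩, hf, rfl⟩
    refine closure_minimal ?_ hcl hd
    rintro ⟨f, hf'⟩ hf
    rw [Set.mem_ofPred_eq] at hf ⊢
    dsimp only at hf
    change ρ.π f = ψ ⟨D.correspondence.φ f, hV f hf'⟩
    induction hf using Submodule.span_induction with
    | mem f hf =>
      obtain ⟨A, hA, rfl⟩ := hf
      rw [h A hA, compactsMap_φ_chi hψ hA]
    | zero =>
      have : (⟨D.correspondence.φ 0, hV 0 hf'⟩ : compacts (FunctionAlg 𝓑) D.HilbertMod) = 0 :=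
        Subtype.ext (map_zero _)
      rw [this, map_zero, map_zero]
    | add x y hx hy ihx ihy =>
      have hx' := Submodule.le_topologicalClosure _ hx
      have hy' := Submodule.le_topologicalClosure _ hy
      have : (⟨D.correspondence.φ (x + y), hV _ hf'⟩ : compacts (FunctionAlg 𝓑) D.HilbertMod) =
          ⟨D.correspondence.φ x, hV x hx'⟩ + ⟨D.correspondence.φ y, hV y hy'⟩ :=
        Subtype.ext (map_add _ _ _)
      rw [this, map_add, map_add, ihx hx', ihy hy']
    | smul c x hx ihx =>
      have hx' := Submodule.le_topologicalClosure _ hx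
      have : (⟨D.correspondence.φ (c • x), hV _ hf'⟩ : compacts (FunctionAlg 𝓑) D.HilbertMod) =
          c • ⟨D.correspondence.φ x, hV x hx'⟩ :=
        Subtype.ext (map_smul _ _ _)
      rw [this, map_smul, map_smul, ihx hx']

end GenBoolDynSystem

/-! ### The topology of the spectrum and the size of functions on it -/

namespace BoolSpectrum

variable {𝓑 : Type*} [GeneralizedBooleanAlgebra 𝓑]

/-- Every non-empty element of `𝓑` belongs to an ultrafilter. -/
theorem exists_mem_carrier {A : 𝓑} (hA : A ≠ ⊥) : ∃ ξ : BoolSpectrum 𝓑, A ∈ ξ.carrier := by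
  have hdisj : Disjoint ((Order.PFilter.principal A : Order.PFilter 𝓑) : Set 𝓑)
      (Order.Ideal.principal (⊥ : 𝓑) : Set 𝓑) := by
    rw [Set.disjoint_left]
    intro b hb hb'
    exact hA (le_bot_iff.1 ((show A ≤ b from hb).trans (show b ≤ ⊥ from hb')))
  obtain ⟨J, hJ, -, hFJ⟩ := DistribLattice.prime_ideal_of_disjoint_filter_ideal hdisj
  have hAJ : A ∉ J := Set.disjoint_left.1 hFJ (show A ≤ A from le_rfl)
  exact ⟨
    { carrier := {b | b ∉ J}
      nonempty := ⟨A, hAJ⟩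
      bot_notMem := fun h => h J.bot_mem
      mem_of_le := fun ha hab hb => ha (J.lower hab hb)
      inf_mem := fun ha hb hab => (hJ.mem_or_mem hab).elim ha hb
      mem_or_mem := fun {a b} h => by
        by_contra hcon
        push Not at hcon
        exact h (Order.Ideal.sup_mem (not_not.1 hcon.1) (not_not.1 hcon.2)) }, hAJ⟩

/-- The generating sets already form a basis: `Z(A) ∩ Z(B) = Z(A ⊓ B)`, and they cover because
ultrafilters are non-empty. -/
theorem exists_Z_subset {U : Set (BoolSpectrum 𝓑)} (hU : IsOpen U) {ξ : BoolSpectrum 𝓑}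
    (hξ : ξ ∈ U) : ∃ A ∈ ξ.carrier, Z A ⊆ U := by
  have hU' : TopologicalSpace.GenerateOpen (Set.range Z) U := hU
  induction hU' with
  | basic s hs =>
    obtain ⟨A, rfl⟩ := hs
    exact ⟨A, hξ, le_rfl⟩
  | univ =>
    obtain ⟨A, hA⟩ := ξ.nonempty
    exact ⟨A, hA, Set.subset_univ _⟩
  | inter s t hs ht ihs iht =>
    obtain ⟨A, hA, hAs⟩ := ihs hs hξ.1
    obtain ⟨B, hB, hBt⟩ := iht ht hξ.2
    exact ⟨A ⊓ B, ξ.inf_mem hA hB, fun η hη =>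
      ⟨hAs (η.mem_of_le hη inf_le_left), hBt (η.mem_of_le hη inf_le_right)⟩⟩
  | sUnion S hS ih =>
    obtain ⟨s, hs, hξs⟩ := hξ
    obtain ⟨A, hA, hAs⟩ := ih s hs (hS s hs) hξs
    exact ⟨A, hA, hAs.trans (Set.subset_sUnion_of_mem hs)⟩

end BoolSpectrum

namespace FunctionAlg

open BoolSpectrum

variable {𝓑 : Type*} [GeneralizedBooleanAlgebra 𝓑]

theorem continuous_eval_apply (f : FunctionAlg 𝓑) : Continuous fun ξ => eval ξ f :=
  (toC₀ f).continuous

theorem exists_forall_lt_norm_eval {f : FunctionAlg 𝓑} {ξ : BoolSpectrum 𝓑} {ε : ℝ}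
    (h : ε < ‖eval ξ f‖) : ∃ A ∈ ξ.carrier, ∀ η ∈ Z A, ε < ‖eval η f‖ :=
  exists_Z_subset (isOpen_lt continuous_const (continuous_eval_apply f).norm) h

theorem isCompact_le_norm_eval (f : FunctionAlg 𝓑) {ε : ℝ} (hε : 0 < ε) :
    IsCompact {ξ : BoolSpectrum 𝓑 | ε ≤ ‖eval ξ f‖} := by
  have h : Filter.Tendsto (fun ξ => eval ξ f) (Filter.cocompact _) (nhds 0) :=
    (toC₀ f).zero_at_infty'
  have h' := h.norm.eventually (gt_mem_nhds (by simpa using hε))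
  obtain ⟨K, hK, hsub⟩ := Filter.mem_cocompact.1 h'
  refine hK.of_isClosed_subset (isClosed_le continuous_const (continuous_eval_apply f).norm) ?_
  intro ξ hξ
  by_contra hn
  exact (not_lt.2 (show ε ≤ ‖eval ξ f‖ from hξ)) (hsub hn)

end FunctionAlg

/-! ### Computation of Katsura's ideal -/

namespace GenBoolDynSystem

open FunctionAlg HilbertMod BoolSpectrum

variable {𝓑 𝓛 : Type*} [GeneralizedBooleanAlgebra 𝓑] {D : GenBoolDynSystem 𝓑 𝓛}

theorem Δ_sup (A B : 𝓑) : D.Δ (A ⊔ B) = D.Δ A ∪ D.Δ B := by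
  ext α
  simp only [Δ, Set.mem_ofPred_eq, Set.mem_union, (D.isBoolAction α).map_sup, ne_eq, sup_eq_bot_iff]
  tauto

theorem reg_of_le {A B : 𝓑} (h : A ≤ B) (hB : B ∈ D.reg) : A ∈ D.reg :=
  fun C hC => hB C (hC.trans h)

variable (D) in
/-- The regular elements form an ideal. -/
def regIdeal : Order.Ideal 𝓑 := Order.IsIdeal.toIdeal (I := D.reg)
  { IsLowerSet := fun _ _ h hA => reg_of_le h hA
    Nonempty := ⟨⊥, fun _ h h' => absurd (le_bot_iff.1 h) h'⟩
    Directed := by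
      intro A hA B hB
      refine ⟨A ⊔ B, fun C hC hC' => ?_, le_sup_left, le_sup_right⟩
      have hsup : C = C ⊓ A ⊔ C ⊓ B := by rw [← inf_sup_left, inf_eq_left.2 hC]
      have hA' : C ⊓ A ∈ D.reg := reg_of_le inf_le_right hA
      have hB' : C ⊓ B ∈ D.reg := reg_of_le inf_le_right hB
      rw [hsup, Δ_sup]
      refine ⟨?_, (finite_Δ_of_mem_reg hA').union (finite_Δ_of_mem_reg hB')⟩
      by_cases h : C ⊓ A = ⊥
      · have hne : C ⊓ B ≠ ⊥ := fun h' => hC' (by rw [hsup, h, h', sup_bot_eq])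
        exact (hB' _ le_rfl hne).1.mono Set.subset_union_right
      · exact (hA' _ le_rfl h).1.mono Set.subset_union_left }

/-- The operator `φ(f)` sees the values of `f` at the points `θ_α⁻¹(η)`. Both inclusions for
Katsura's ideal read off information about `f` through this formula. -/
theorem eval_φ_e (f : FunctionAlg 𝓑) {α : 𝓛} {A : 𝓑} {η : BoolSpectrum 𝓑}
    (hη : D.θ α A ∈ η.carrier) :
    eval η ((D.correspondence.φ f (e α ⟨D.θ α A, D.mem_I α A⟩)).coord α) =
      eval (comapPoint (D.isBoolAction α) η ⟨A, hη⟩) f := by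
  rw [φ_apply_coord, coord_e, if_pos rfl, map_mul, eval_chi, if_pos hη, mul_one, eval_pull,
    pullEval, dif_pos ⟨A, hη⟩]

/-- If `g` were non-zero at a point of `Z(A)`, it would have no zero on `Z(B)` for some `B` with `A
⊓ B ≠ ∅`. Regularity gives `α` with `θ_α(A ⊓ B) ≠ ∅`; the preimage under `θ_α` of an ultrafilter
containing this set is a point of `Z(B)` at which `φ(g) = 0` forces `g` to vanish. -/
theorem chi_mul_eq_zero_of_mem_reg {A : 𝓑} (hA : A ∈ D.reg) {g : FunctionAlg 𝓑}
    (hg : D.correspondence.φ g = 0) : chi A * g = 0 := by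
  refine ext_eval fun ξ => ?_
  rw [map_mul, eval_chi, map_zero]
  split_ifs with hξ
  · rw [one_mul]
    by_contra hne
    obtain ⟨B, hB, hBg⟩ := exists_forall_lt_norm_eval (norm_pos_iff.2 hne)
    have hAB : A ⊓ B ≠ ⊥ := fun h => ξ.bot_notMem (h ▸ ξ.inf_mem hξ hB)
    obtain ⟨α, hα⟩ := (hA _ inf_le_left hAB).1
    obtain ⟨η, hη⟩ := exists_mem_carrier hα
    have h0 := eval_φ_e (D := D) g hη
    rw [hg] at h0
    have h1 : eval (comapPoint (D.isBoolAction α) η ⟨A ⊓ B, hη⟩) g = 0 := by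
      rw [← h0]
      exact map_zero _
    have h2 := hBg (comapPoint (D.isBoolAction α) η ⟨A ⊓ B, hη⟩)
      (η.mem_of_le hη ((D.isBoolAction α).mono inf_le_right))
    rw [h1, norm_zero] at h2
    exact lt_irrefl _ h2
  · rw [zero_mul]

/-- Compact operators are small on all but finitely many coordinates. -/
theorem finite_of_mem_compacts {T : D.HilbertMod →L[ℂ] D.HilbertMod}
    (hT : T ∈ CStarCorrespondence.compacts (FunctionAlg 𝓑) D.HilbertMod) {ε : ℝ} (hε : 0 < ε) :
    {α : 𝓛 | ∃ A : D.I α, ε ≤ ‖T (e α A)‖}.Finite := by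
  have hspan : ∀ T ∈ Submodule.span ℂ (Set.range fun p : D.HilbertMod × D.HilbertMod =>
      CStarCorrespondence.Θ (FunctionAlg 𝓑) p.1 p.2), ∀ ε > 0,
        {α : 𝓛 | ∃ A : D.I α, ε ≤ ‖T (e α A)‖}.Finite := by
    intro T hT
    induction hT using Submodule.span_induction with
    | mem T h =>
      obtain ⟨⟨x, y⟩, rfl⟩ := h
      intro ε hε
      -- The bound `‖Θ_{x,y} e_{α,A}‖ ≤ ‖x‖ ‖y_α‖` is uniform in `A`, and `y_α` tends to zero
      -- because `∑ y_α^* y_α` converges.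
      have h0 : Filter.Tendsto (fun α => ‖x‖ * ‖y.coord α‖) Filter.cofinite (nhds 0) := by
        have h1 := ((y.summable_coord y).tendsto_cofinite_zero).norm
        simp only [CStarRing.norm_star_mul_self, norm_zero] at h1
        have h2 := ((Real.continuous_sqrt.tendsto 0).comp h1).const_mul ‖x‖
        rw [Real.sqrt_zero, mul_zero] at h2
        refine h2.congr fun α => ?_
        rw [Function.comp_apply, Real.sqrt_mul_self (norm_nonneg _)]
      have h1 : ∀ᶠ α in Filter.cofinite, ‖x‖ * ‖y.coord α‖ < ε :=
        h0.eventually (gt_mem_nhds hε)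
      refine (Filter.eventually_cofinite.1 h1).subset ?_
      rintro α ⟨A, hA⟩
      rw [Set.mem_ofPred_eq, not_lt]
      refine hA.trans ?_
      rw [CStarCorrespondence.Θ_apply, ← CStarModule.star_inner, inner_e_left, mul_comm ‖x‖]
      refine (CStarCorrespondence.norm_action_le _ _).trans ?_
      gcongr
      rw [norm_star]
      refine (norm_mul_le _ _).trans ?_
      exact mul_le_of_le_one_left (norm_nonneg _) (norm_chi_le _)
    | zero =>
      intro ε hε
      refine Set.finite_empty.subset ?_
      rintro α ⟨A, hA⟩
      rw [zero_apply, norm_zero] at hA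
      exact absurd hA (not_le.2 hε)
    | add T U _ _ hT hU =>
      intro ε hε
      refine ((hT (ε / 2) (by positivity)).union (hU (ε / 2) (by positivity))).subset ?_
      rintro α ⟨A, hA⟩
      by_contra hn
      simp only [Set.mem_union, Set.mem_ofPred_eq, not_or, not_exists, not_le] at hn
      rw [add_apply] at hA
      linarith [norm_add_le (T (e α A)) (U (e α A)), hn.1 A, hn.2 A]
    | smul c T _ hT =>
      intro ε hε
      -- The added `1` covers the case `c = 0`.
      refine (hT (ε / (‖c‖ + 1)) (by positivity)).subset ?_
      rintro α ⟨A, hA⟩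
      refine ⟨A, ?_⟩
      rw [smul_apply, norm_smul] at hA
      rw [div_le_iff₀ (by positivity)]
      nlinarith [norm_nonneg (T (e α A)), norm_nonneg c]
  -- As `‖e_{α,A}‖ ≤ 1`, replacing `T` by a finite-rank `U` within `ε / 2` costs at most `ε / 2` in
  -- every coordinate at once.
  obtain ⟨U, hU, hTU⟩ := Metric.mem_closure_iff.1 (show T ∈ closure _ from hT) (ε / 2)
    (by positivity)
  refine (hspan U hU (ε / 2) (by positivity)).subset ?_
  rintro α ⟨A, hA⟩
  refine ⟨A, ?_⟩
  rw [dist_eq_norm] at hTU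
  have h1 : ‖(T - U) (e α A)‖ ≤ ‖T - U‖ :=
    ((T - U).le_opNorm _).trans (mul_le_of_le_one_right (norm_nonneg _) (norm_e_le α A))
  rw [sub_apply] at h1
  have h2 := norm_sub_norm_le (T (e α A)) (U (e α A))
  linarith

/-- Each half of the definition of `J_X` gives one half of regularity. Orthogonality to `ker φ`
excludes an empty `Δ_B`, because then `χ_B` lies in `ker φ` while `f χ_B ≠ 0`. Compactness of `φ(f)`
makes `Δ_B` finite, because `‖φ(f) e_{α,θ_α(B)}‖ ≥ ε` for every `α` in `Δ_B`. -/
theorem mem_reg_of_mem_katsuraIdeal {f : FunctionAlg 𝓑} (hf : f ∈ D.correspondence.katsuraIdeal)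
    {ε : ℝ} (hε : 0 < ε) {A : 𝓑} (hA : ∀ η ∈ Z A, ε < ‖eval η f‖) : A ∈ D.reg := by
  intro B hBA hB
  constructor
  · by_contra hn
    have hφ : D.correspondence.φ (chi B) = 0 := by
      refine ContinuousLinearMap.ext fun x => ext_coord fun α => ?_
      rw [φ_apply_coord, pull_chi]
      have : D.θ α B = ⊥ := by
        by_contra h
        exact hn ⟨α, h⟩
      rw [this, chi_bot, zero_mul]
      rfl
    obtain ⟨η, hη⟩ := exists_mem_carrier hB
    have h1 := congrArg (eval η) (hf.2 _ hφ)
    rw [map_mul, eval_chi, if_pos hη, mul_one, map_zero] at h1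
    have h2 := hA η (η.mem_of_le hη hBA)
    rw [h1, norm_zero] at h2
    linarith
  · refine (finite_of_mem_compacts hf.1 hε).subset ?_
    intro α hα
    obtain ⟨η, hη⟩ := exists_mem_carrier (show D.θ α B ≠ ⊥ from hα)
    refine ⟨⟨D.θ α B, D.mem_I α B⟩, ?_⟩
    refine le_trans ?_ (norm_coord_le _ α)
    refine le_trans ?_ (norm_eval_le η _)
    rw [eval_φ_e f hη]
    exact (hA _ (show D.θ α A ∈ η.carrier from
      η.mem_of_le hη ((D.isBoolAction α).mono hBA))).le

/-- Katsura's ideal is the closed linear span of the indicators of the regular elements. -/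
theorem katsuraIdeal_eq : D.correspondence.katsuraIdeal =
    closure (Submodule.span ℂ (chi '' D.reg) : Set (FunctionAlg 𝓑)) := by
  refine Set.Subset.antisymm (fun f hf => ?_) ?_
  -- The approximants `f χ_A` lie in the closed span and not in the span itself, hence the second
  -- closure.
  · rw [← closure_closure, Metric.mem_closure_iff]
    intro ε hε
    obtain ⟨A, hA, hfA⟩ : ∃ A ∈ D.reg, ∀ ξ, ε / 2 ≤ ‖eval ξ f‖ → A ∈ ξ.carrier := by
      refine (isCompact_le_norm_eval f (half_pos hε)).induction_on
        (p := fun s => ∃ A ∈ D.reg, ∀ ξ ∈ s, A ∈ ξ.carrier)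
        ⟨⊥, fun _ h h' => absurd (le_bot_iff.1 h) h', by simp⟩ ?_ ?_ ?_
      · rintro s t hst ⟨A, hA, h⟩
        exact ⟨A, hA, fun ξ hξ => h ξ (hst hξ)⟩
      · rintro s t ⟨A, hA, hs⟩ ⟨B, hB, ht⟩
        refine ⟨A ⊔ B, Order.Ideal.sup_mem (s := D.regIdeal) hA hB, ?_⟩
        rintro ξ (h | h)
        · exact ξ.mem_of_le (hs ξ h) le_sup_left
        · exact ξ.mem_of_le (ht ξ h) le_sup_right
      · intro ξ hξ
        -- The smaller threshold `ε / 4` turns `≥ ε / 2` at `ξ` into a strict inequality, which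
        -- persists on a neighbourhood `Z(A)`.
        obtain ⟨A, hA, hAf⟩ := exists_forall_lt_norm_eval (f := f) (ξ := ξ) (ε := ε / 4)
          (by have : ε / 2 ≤ ‖eval ξ f‖ := hξ
              linarith)
        exact ⟨Z A, mem_nhdsWithin_of_mem_nhds ((isOpen_Z A).mem_nhds hA), A,
          mem_reg_of_mem_katsuraIdeal hf (by positivity) hAf, fun _ h => h⟩
    -- The regular elements form an ideal, so their closed span absorbs `f`. The error `f - f χ_A`
    -- lives off `Z(A)`, where `|f| < ε / 2`.
    refine ⟨f * chi A, mul_mem_chiSpan D.regIdeal f (chi_mem_chiSpan (S := D.reg) hA), ?_⟩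
    rw [dist_eq_norm]
    refine lt_of_le_of_lt (norm_le (c := ε / 2) (by positivity) fun ξ => ?_) (half_lt_self hε)
    rw [map_sub, map_mul, eval_chi]
    split_ifs with h
    · simp; positivity
    · rw [mul_zero, sub_zero]
      by_contra! hn
      exact h (hfA ξ hn.le)
  · have hcl : IsClosed D.correspondence.katsuraIdeal := by
      have h1 : IsClosed (CStarCorrespondence.compacts (FunctionAlg 𝓑) D.HilbertMod :
          Set (D.HilbertMod →L[ℂ] D.HilbertMod)) := Submodule.isClosed_topologicalClosure _
      have h2 : IsClosed {f | ∀ g, D.correspondence.φ g = 0 → f * g = 0} := by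
        simp only [Set.ofPred_forall]
        exact isClosed_iInter fun g => isClosed_iInter fun _ =>
          isClosed_eq (by fun_prop) continuous_const
      exact (h1.preimage continuous_φ).inter h2
    refine closure_minimal (fun f hf => ?_) hcl
    induction hf using Submodule.span_induction with
    | mem f h =>
      obtain ⟨A, hA, rfl⟩ := h
      exact ⟨φ_chi_mem_compacts hA, fun g hg => chi_mul_eq_zero_of_mem_reg hA hg⟩
    | zero => exact ⟨by rw [map_zero]; exact zero_mem _, by simp⟩
    | add f g _ _ hf hg =>
      exact ⟨by rw [map_add]; exact add_mem hf.1 hg.1, fun h hh => by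
        rw [add_mul, hf.2 h hh, hg.2 h hh, add_zero]⟩
    | smul c f _ hf =>
      exact ⟨by rw [map_smul]; exact Submodule.smul_mem _ c hf.1, fun h hh => by
        rw [smul_mul_assoc, hf.2 h hh, smul_zero]⟩

end GenBoolDynSystem

/-! ### Existence of universal representations -/

/-- Formal non-unital `*`-polynomials in the variables `g : G`. -/
inductive StarTerm (G : Type*) where
  | var (g : G) : StarTerm G
  | zero : StarTerm G
  | add (s t : StarTerm G) : StarTerm G
  | mul (s t : StarTerm G) : StarTerm G
  | smul (c : ℂ) (t : StarTerm G) : StarTerm G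
  | star (t : StarTerm G) : StarTerm G

namespace StarTerm

variable {G : Type*} {𝒳 𝒴 : Type*} [NonUnitalCStarAlgebra 𝒳] [NonUnitalCStarAlgebra 𝒴]

/-- The value of a formal `*`-polynomial. -/
noncomputable def eval (a : G → 𝒳) : StarTerm G → 𝒳
  | var g => a g
  | zero => 0
  | add s t => eval a s + eval a t
  | mul s t => eval a s * eval a t
  | smul c t => c • eval a t
  | star t => Star.star (eval a t)

theorem map_eval (Ψ : 𝒳 →⋆ₙₐ[ℂ] 𝒴) (a : G → 𝒳) (t : StarTerm G) :
    Ψ (eval a t) = eval (fun g => Ψ (a g)) t := by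
  induction t with
  | var g => rfl
  | zero => exact map_zero Ψ
  | add s t hs ht => simp only [eval, map_add, hs, ht]
  | mul s t hs ht => simp only [eval, map_mul, hs, ht]
  | smul c t ht => simp only [eval, map_smul, ht]
  | star t ht => simp only [eval, map_star, ht]

theorem exists_eval_eq {a : G → 𝒳} {b : G → 𝒴} {p : 𝒳 × 𝒴}
    (hp : p ∈ NonUnitalStarAlgebra.adjoin ℂ (Set.range fun g => (a g, b g))) :
    ∃ t, p = (eval a t, eval b t) := by
  induction hp using NonUnitalStarAlgebra.adjoin_induction with
  | mem p h =>
    obtain ⟨g, rfl⟩ := h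
    exact ⟨var g, rfl⟩
  | zero => exact ⟨zero, rfl⟩
  | add p q _ _ hp hq =>
    obtain ⟨s, rfl⟩ := hp
    obtain ⟨t, rfl⟩ := hq
    exact ⟨add s t, rfl⟩
  | mul p q _ _ hp hq =>
    obtain ⟨s, rfl⟩ := hp
    obtain ⟨t, rfl⟩ := hq
    exact ⟨mul s t, rfl⟩
  | smul c p _ hp =>
    obtain ⟨s, rfl⟩ := hp
    exact ⟨smul c s, rfl⟩
  | star p _ hp =>
    obtain ⟨s, rfl⟩ := hp
    exact ⟨star s, rfl⟩

/-- If the `*`-polynomials in `b` are dominated in norm by those in `a`, then a `*`-homomorphism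
maps the generators `a` to `b`. -/
theorem exists_starHom {a : G → 𝒳} {b : G → 𝒴}
    (ha : (NonUnitalStarAlgebra.adjoin ℂ (Set.range a)).topologicalClosure = ⊤)
    (h : ∀ t, ‖eval b t‖ ≤ ‖eval a t‖) : ∃ Ψ : 𝒳 →⋆ₙₐ[ℂ] 𝒴, ∀ g, Ψ (a g) = b g := by
  obtain ⟨Ψ, hΨ⟩ := (NonUnitalStarAlgebra.adjoin ℂ
      (Set.range fun g => (a g, b g))).exists_starHom_of_graph
    (fun p hp => by
      obtain ⟨t, rfl⟩ := exists_eval_eq hp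
      exact h t)
    (fun x => by
      have hx : x ∈ (NonUnitalStarAlgebra.adjoin ℂ (Set.range a)).topologicalClosure := by
        rw [ha]; trivial
      refine closure_mono (fun y hy => ?_) hx
      have hle : NonUnitalStarAlgebra.adjoin ℂ (Set.range a) ≤
          (NonUnitalStarAlgebra.adjoin ℂ (Set.range fun g => (a g, b g))).map
            (NonUnitalStarAlgHom.fst ℂ 𝒳 𝒴) := by
        refine NonUnitalStarAlgebra.adjoin_le ?_
        rintro _ ⟨g, rfl⟩
        exact ⟨(a g, b g), NonUnitalStarAlgebra.subset_adjoin ℂ _ ⟨g, rfl⟩, rfl⟩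
      exact hle hy)
  exact ⟨Ψ, fun g => hΨ (a g, b g) (NonUnitalStarAlgebra.subset_adjoin ℂ _ ⟨g, rfl⟩)⟩

end StarTerm

/-- Two `*`-homomorphisms that agree on generators are equal. -/
theorem NonUnitalStarAlgHom.ext_of_topologicalClosure_adjoin {𝒳 𝒴 : Type*}
    [NonUnitalCStarAlgebra 𝒳] [NonUnitalCStarAlgebra 𝒴] {s : Set 𝒳}
    (hs : (NonUnitalStarAlgebra.adjoin ℂ s).topologicalClosure = ⊤) {Ψ Φ : 𝒳 →⋆ₙₐ[ℂ] 𝒴}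
    (h : ∀ x ∈ s, Ψ x = Φ x) : Ψ = Φ := by
  have hc : ∀ Ψ : 𝒳 →⋆ₙₐ[ℂ] 𝒴, Continuous Ψ := fun Ψ =>
    AddMonoidHomClass.continuous_of_bound Ψ 1 fun x => by
      simpa using NonUnitalStarAlgHom.norm_apply_le Ψ x
  ext x
  have hx : x ∈ (NonUnitalStarAlgebra.adjoin ℂ s).topologicalClosure := by rw [hs]; trivial
  refine closure_minimal (fun x hx => ?_) (isClosed_eq (hc Ψ) (hc Φ)) hx
  rw [Set.mem_ofPred_eq]
  induction hx using NonUnitalStarAlgebra.adjoin_induction with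
  | mem x hx => exact h x hx
  | zero => simp
  | add x y _ _ hx hy => simp [hx, hy]
  | mul x y _ _ hx hy => simp [hx, hy]
  | smul c x _ hx => simp [hx]
  | star x _ hx => simp [map_star, hx]

open scoped ENNReal in
/-- The coordinate projections of an `ℓ^∞`-product of `C*`-algebras. -/
noncomputable def lp.coordHom {ι : Type*} (𝒳 : ι → Type*) [∀ i, NonUnitalCStarAlgebra (𝒳 i)]
    (i : ι) : lp 𝒳 ∞ →⋆ₙₐ[ℂ] 𝒳 i where
  toFun x := x i
  map_smul' _ _ := rfl
  map_zero' := rfl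
  map_add' _ _ := rfl
  map_mul' _ _ := rfl
  map_star' _ := rfl

/-- A bounded family of generators, subject to relations that are inherited by products and
reflected by jointly injective families of `*`-homomorphisms, has a universal representation. -/
theorem exists_universal {G : Type w} (Rel : ∀ (𝒳 : Type w) [NonUnitalCStarAlgebra 𝒳], (G → 𝒳) → Prop)
    (hbd : ∀ (𝒳 : Type w) [NonUnitalCStarAlgebra 𝒳] (a : G → 𝒳), Rel 𝒳 a → ∀ g, ‖a g‖ ≤ 1)
    (hrefl : ∀ (𝒳 : Type w) [NonUnitalCStarAlgebra 𝒳] (a : G → 𝒳) (ι : Type w) (𝒴 : ι → Type w)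
      [∀ i, NonUnitalCStarAlgebra (𝒴 i)] (Ψ : ∀ i, 𝒳 →⋆ₙₐ[ℂ] 𝒴 i),
      (∀ x y, (∀ i, Ψ i x = Ψ i y) → x = y) → (∀ i, Rel (𝒴 i) fun g => Ψ i (a g)) → Rel 𝒳 a) :
    ∃ (𝒳 : Type w) (_ : NonUnitalCStarAlgebra 𝒳) (a : G → 𝒳), Rel 𝒳 a ∧
      (NonUnitalStarAlgebra.adjoin ℂ (Set.range a)).topologicalClosure = ⊤ ∧
      ∀ (𝒴 : Type w) [NonUnitalCStarAlgebra 𝒴] (b : G → 𝒴), Rel 𝒴 b →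
        ∃ Ψ : 𝒳 →⋆ₙₐ[ℂ] 𝒴, ∀ g, Ψ (a g) = b g := by
  -- the index set consists of the functions `t ↦ ‖t(b)‖`, so that it is small
  let ι : Type w := {n : StarTerm G → ℝ // ∃ (𝒴 : Type w) (_ : NonUnitalCStarAlgebra 𝒴)
    (b : G → 𝒴), Rel 𝒴 b ∧ ∀ t, ‖StarTerm.eval b t‖ = n t}
  choose 𝒴 inst b hb hn using fun i : ι => i.2
  -- The uniform bound on generators is what places them in the `ℓ^∞`-product.
  have hmem : ∀ g, Memℓp (fun i => b i g) ⊤ := fun g =>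
    memℓp_infty ⟨1, by rintro _ ⟨i, rfl⟩; exact hbd (𝒴 i) (b i) (hb i) g⟩
  let c : G → lp 𝒴 ⊤ := fun g => ⟨fun i => b i g, hmem g⟩
  let S : NonUnitalStarSubalgebra ℂ (lp 𝒴 ⊤) :=
    (NonUnitalStarAlgebra.adjoin ℂ (Set.range c)).topologicalClosure
  have hS : IsClosed (S : Set (lp 𝒴 ⊤)) := NonUnitalStarSubalgebra.isClosed_topologicalClosure _
  let a : G → S := fun g => ⟨c g, NonUnitalStarSubalgebra.le_topologicalClosure _
    (NonUnitalStarAlgebra.subset_adjoin ℂ _ ⟨g, rfl⟩)⟩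
  let Ψ : ∀ i, S →⋆ₙₐ[ℂ] 𝒴 i := fun i =>
    (lp.coordHom 𝒴 i).comp (NonUnitalStarSubalgebraClass.subtype S)
  have hgen : (NonUnitalStarAlgebra.adjoin ℂ (Set.range a)).topologicalClosure = ⊤ := by
    refine eq_top_iff.2 fun x _ => ?_
    change x ∈ closure _
    rw [Topology.IsInducing.subtypeVal.closure_eq_preimage_closure_image]
    refine closure_mono ?_ (show (x : lp 𝒴 ⊤) ∈ closure _ from x.2)
    have hle : NonUnitalStarAlgebra.adjoin ℂ (Set.range c) ≤
        (NonUnitalStarAlgebra.adjoin ℂ (Set.range a)).map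
          (NonUnitalStarSubalgebraClass.subtype S) := by
      refine NonUnitalStarAlgebra.adjoin_le ?_
      rintro _ ⟨g, rfl⟩
      exact ⟨a g, NonUnitalStarAlgebra.subset_adjoin ℂ _ ⟨g, rfl⟩, rfl⟩
    exact fun y hy => hle hy
  refine ⟨S, inferInstance, a, ?_, hgen, fun 𝒵 _ d hd => ?_⟩
  · refine hrefl S a ι 𝒴 Ψ (fun x y h => ?_) fun i => hb i
    exact Subtype.ext (lp.ext (funext fun i => h i))
  -- The representation `d` need not be one of the chosen ones, but the one chosen at its norm
  -- function has the same norms on all `*`-polynomials, and it is a coordinate of `a`.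
  · let i : ι := ⟨fun t => ‖StarTerm.eval d t‖, 𝒵, inferInstance, d, hd, fun _ => rfl⟩
    refine StarTerm.exists_starHom hgen fun t => ?_
    rw [show ‖StarTerm.eval d t‖ = ‖StarTerm.eval (b i) t‖ from (hn i t).symm]
    refine le_trans (le_of_eq ?_) (NonUnitalStarAlgHom.norm_apply_le (Ψ i) (StarTerm.eval a t))
    rw [StarTerm.map_eval]
    rfl

/-- The image of a representation of a correspondence under a `*`-homomorphism. -/
def CStarCorrespondence.Rep.map {A X : Type*} [NonUnitalCommCStarAlgebra A] [PartialOrder A]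
    [NormedAddCommGroup X] [NormedSpace ℂ X] [SMul A X] [CStarModule A X]
    {C : CStarCorrespondence A X} {𝒳 𝒴 : Type*} [NonUnitalCStarAlgebra 𝒳]
    [NonUnitalCStarAlgebra 𝒴] (ρ : C.Rep 𝒳) (Ψ : 𝒳 →⋆ₙₐ[ℂ] 𝒴) : C.Rep 𝒴 where
  π := Ψ.comp ρ.π
  t := (Ψ : 𝒳 →ₗ[ℂ] 𝒴).comp ρ.t
  star_t_mul_t x y := by
    change star (Ψ (ρ.t x)) * Ψ (ρ.t y) = Ψ (ρ.π _)
    rw [← map_star, ← map_mul, ρ.star_t_mul_t]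
  π_mul_t f x := by
    change Ψ (ρ.π f) * Ψ (ρ.t x) = Ψ (ρ.t _)
    rw [← map_mul, ρ.π_mul_t]

/-! ### Universal algebras of the system and of its correspondence -/

namespace GenBoolDynSystem

open FunctionAlg HilbertMod

namespace Rep

theorem norm_S_le {𝓑 𝓛 : Type*} [GeneralizedBooleanAlgebra 𝓑] {D : GenBoolDynSystem 𝓑 𝓛}
    {J : Set 𝓑} {𝒳 : Type*} [NonUnitalCStarAlgebra 𝒳] (R : D.Rep J 𝒳) (α : 𝓛) (B : D.I α) :
    ‖R.S α B‖ ≤ 1 := by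
  refine le_of_sq_le_sq ?_ zero_le_one
  rw [sq, ← CStarRing.norm_star_mul_self, R.star_S_mul_S, if_pos rfl, one_pow]
  exact (R.isStarProjection_P _).norm_le

variable {𝓑 : Type u} {𝓛 : Type v} [GeneralizedBooleanAlgebra 𝓑] {D : GenBoolDynSystem 𝓑 𝓛}

/-- Every relation is an identity between `*`-polynomials, so jointly injective families of
`*`-homomorphisms reflect it. Finiteness of `Δ_A` serves relation (iv), whose sum must commute with
homomorphisms. -/
theorem exists_isUniversal {J : Set 𝓑} (hJ : ∀ A ∈ J, (D.Δ A).Finite) :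
    ∃ (𝒳 : Type (max u v w)) (_ : NonUnitalCStarAlgebra 𝒳) (R : D.Rep J 𝒳), R.IsUniversal := by
  classical
  -- The generators are lifted so that the index set of norm functions lies in the universe of the
  -- algebras.
  let G : Type (max u v w) := ULift.{max u v w} (𝓑 ⊕ Σ α, D.I α)
  let Rel : ∀ (𝒳 : Type (max u v w)) [NonUnitalCStarAlgebra 𝒳], (G → 𝒳) → Prop :=
    fun 𝒳 _ a => ∃ R : D.Rep J 𝒳, a = fun g => Sum.elim R.P (fun p => R.S p.1 p.2) g.down
  have hbd : ∀ (𝒳 : Type (max u v w)) [NonUnitalCStarAlgebra 𝒳] (a : G → 𝒳), Rel 𝒳 a →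
      ∀ g, ‖a g‖ ≤ 1 := by
    rintro 𝒳 _ _ ⟨R, rfl⟩ ⟨A | ⟨α, B⟩⟩
    · exact (R.isStarProjection_P A).norm_le
    · exact R.norm_S_le α B
  have hrefl : ∀ (𝒳 : Type (max u v w)) [NonUnitalCStarAlgebra 𝒳] (a : G → 𝒳)
      (ι : Type (max u v w)) (𝒴 : ι → Type (max u v w)) [∀ i, NonUnitalCStarAlgebra (𝒴 i)]
      (Ψ : ∀ i, 𝒳 →⋆ₙₐ[ℂ] 𝒴 i), (∀ x y, (∀ i, Ψ i x = Ψ i y) → x = y) →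
      (∀ i, Rel (𝒴 i) fun g => Ψ i (a g)) → Rel 𝒳 a := by
    intro 𝒳 _ a ι 𝒴 _ Ψ hinj h
    choose Q hQ using h
    have hP : ∀ i A, Ψ i (a ⟨Sum.inl A⟩) = (Q i).P A := fun i A => congrFun (hQ i) ⟨Sum.inl A⟩
    have hS : ∀ i α B, Ψ i (a ⟨Sum.inr ⟨α, B⟩⟩) = (Q i).S α B := fun i α B =>
      congrFun (hQ i) ⟨Sum.inr ⟨α, B⟩⟩
    refine ⟨
      { P := fun A => a ⟨Sum.inl A⟩
        S := fun α B => a ⟨Sum.inr ⟨α, B⟩⟩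
        isStarProjection_P := fun A => ⟨hinj _ _ fun i => ?_, hinj _ _ fun i => ?_⟩
        partialIsometry_S := fun α B => hinj _ _ fun i => ?_
        P_bot := hinj _ _ fun i => ?_
        P_inf := fun A A' => hinj _ _ fun i => ?_
        P_sup := fun A A' => hinj _ _ fun i => ?_
        P_mul_S := fun A α B => hinj _ _ fun i => ?_
        star_S_mul_S := fun α α' B B' => hinj _ _ fun i => ?_
        P_eq_sum := fun A hA => hinj _ _ fun i => ?_ }, ?_⟩
    · rw [map_mul, hP, ((Q i).isStarProjection_P A).isIdempotentElem]
    · rw [map_star, hP, ((Q i).isStarProjection_P A).isSelfAdjoint]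
    · rw [map_mul, map_mul, map_star, hS, (Q i).partialIsometry_S]
    · rw [hP, (Q i).P_bot, map_zero]
    · rw [map_mul, hP, hP, hP, (Q i).P_inf]
    · rw [map_sub, map_add, hP, hP, hP, hP, (Q i).P_sup]
    · rw [map_mul, map_mul, hP, hS, hP, (Q i).P_mul_S]
    · rw [map_mul, map_star, hS, hS, (Q i).star_S_mul_S, apply_ite (Ψ i), hP, map_zero]
    · rw [hP, (Q i).P_eq_sum A hA]
      refine Eq.trans ?_ ((Ψ i : 𝒳 →+ 𝒴 i).map_finsum_mem _ (hJ A hA)).symm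
      simp only [AddMonoidHom.coe_coe, map_mul, map_star, hS]
    · funext ⟨g⟩
      rcases g with A | ⟨α, B⟩ <;> rfl
  obtain ⟨𝒳, inst, a, ⟨R, rfl⟩, hgen, huniv⟩ := exists_universal Rel hbd hrefl
  have hrange : (Set.range fun g : G => Sum.elim R.P (fun p => R.S p.1 p.2) g.down) =
      Set.range R.P ∪ Set.range fun p : Σ α, D.I α => R.S p.1 p.2 := by
    rw [← Set.Sum.elim_range]
    exact ULift.down_surjective.range_comp (Sum.elim R.P fun p : Σ α, D.I α => R.S p.1 p.2)
  rw [hrange] at hgen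
  refine ⟨𝒳, inst, R, hgen, fun 𝒴 _ Q => ?_⟩
  obtain ⟨Ψ, hΨ⟩ := huniv 𝒴 _ ⟨Q, rfl⟩
  refine ⟨Ψ, ⟨fun A => hΨ ⟨Sum.inl A⟩, fun α B => hΨ ⟨Sum.inr ⟨α, B⟩⟩⟩, fun Φ hΦ => ?_⟩
  refine NonUnitalStarAlgHom.ext_of_topologicalClosure_adjoin hgen ?_
  rintro _ (⟨A, rfl⟩ | ⟨⟨α, B⟩, rfl⟩)
  · exact (hΦ.1 A).trans (hΨ ⟨Sum.inl A⟩).symm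
  · exact (hΦ.2 α B).trans (hΨ ⟨Sum.inr ⟨α, B⟩⟩).symm

section Transfer

variable {J : Set 𝓑} {K : Set (FunctionAlg 𝓑)}

variable (D J K) in
/-- Relation (iv) for `J` is the same as `K`-coisometricity. -/
def RelationsMatch : Prop :=
  ∀ (𝒳 : Type w) [NonUnitalCStarAlgebra 𝒳] (ρ : D.correspondence.Rep 𝒳),
    ρ.IsCoisometric K ↔ ∀ A ∈ J, ρ.π (chi A) = ∑ᶠ α ∈ D.Δ A,
      ρ.t (e α ⟨D.θ α A, D.mem_I α A⟩) * star (ρ.t (e α ⟨D.θ α A, D.mem_I α A⟩))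

theorem isCoisometric_of_eq (hJK : RelationsMatch.{u, v, w} D J K) {𝒳 : Type w}
    [NonUnitalCStarAlgebra 𝒳] {R : D.Rep J 𝒳} {ρ : D.correspondence.Rep 𝒳}
    (hP : ∀ A, ρ.π (chi A) = R.P A) (hS : ∀ α B, ρ.t (e α B) = R.S α B) : ρ.IsCoisometric K := by
  refine (hJK 𝒳 ρ).2 fun A hA => ?_
  simp only [hP, hS]
  exact R.P_eq_sum A hA

/-- A `K`-coisometric `σ` restricts to a representation of the system, universality of `R` supplies
the homomorphism, and density of the spans of the `χ_A` and `e_{α,B}` extends the intertwining from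
generators to all of `𝒜(𝓑)` and `X`. -/
theorem IsUniversal.isRelCuntzPimsnerAlgebra (hJK : RelationsMatch.{u, v, w} D J K) {𝒳 : Type w}
    [NonUnitalCStarAlgebra 𝒳] {R : D.Rep J 𝒳} (hR : R.IsUniversal)
    {ρ : D.correspondence.Rep 𝒳} (hP : ∀ A, ρ.π (chi A) = R.P A)
    (hS : ∀ α B, ρ.t (e α B) = R.S α B) : ρ.IsRelCuntzPimsnerAlgebra K := by
  refine ⟨isCoisometric_of_eq hJK hP hS, ?_, fun 𝒴 _ σ hσ => ?_⟩
  · refine eq_top_iff.2 (hR.1.ge.trans ?_)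
    refine NonUnitalStarSubalgebra.topologicalClosure_mono (NonUnitalStarAlgebra.adjoin_mono ?_)
    rintro _ (⟨A, rfl⟩ | ⟨⟨α, B⟩, rfl⟩)
    · exact Or.inl ⟨chi A, hP A⟩
    · exact Or.inr ⟨e α B, hS α B⟩
  · obtain ⟨Ψ, ⟨hΨP, hΨS⟩, huniq⟩ := hR.2 𝒴 (ofCorr σ J ((hJK 𝒴 σ).1 hσ))
    refine ⟨Ψ, ?_, fun Φ hΦ => huniq Φ ⟨fun A => ?_, fun α B => ?_⟩⟩
    · refine corrRep_ext (ρ := ρ.map Ψ) (σ := σ) (fun A => ?_) fun α B => ?_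
      · change Ψ (ρ.π (chi A)) = _
        rw [hP, hΨP]; rfl
      · change Ψ (ρ.t (e α B)) = _
        rw [hS, hΨS]; rfl
    · rw [← hP, hΦ.1]; rfl
    · rw [← hS, hΦ.2]; rfl

/-- Both universal properties apply, each to the translation of the other's representation. The two
homomorphisms are mutually inverse by the uniqueness clauses. -/
theorem IsUniversal.exists_starAlgEquiv (hJK : RelationsMatch.{u, v, w} D J K) {𝒳 𝒴 : Type w}
    [NonUnitalCStarAlgebra 𝒳] [NonUnitalCStarAlgebra 𝒴] {R : D.Rep J 𝒳} (hR : R.IsUniversal)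
    {ρ : D.correspondence.Rep 𝒴} (hρ : ρ.IsRelCuntzPimsnerAlgebra K) :
    ∃ Φ : 𝒳 ≃⋆ₐ[ℂ] 𝒴, (∀ A, Φ (R.P A) = ρ.π (chi A)) ∧ ∀ α B, Φ (R.S α B) = ρ.t (e α B) := by
  obtain ⟨σ, hσP, hσS⟩ := R.exists_corrRep
  obtain ⟨Φ, ⟨hΦP, hΦS⟩, -⟩ := hR.2 𝒴 (ofCorr ρ J ((hJK 𝒴 ρ).1 hρ.1))
  obtain ⟨Ψ, ⟨hΨπ, hΨt⟩, -⟩ := hρ.2.2 𝒳 σ (isCoisometric_of_eq hJK hσP hσS)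
  replace hΦP : ∀ A, Φ (R.P A) = ρ.π (chi A) := hΦP
  replace hΦS : ∀ α B, Φ (R.S α B) = ρ.t (e α B) := hΦS
  have h1 : Ψ.comp Φ = NonUnitalStarAlgHom.id ℂ 𝒳 := by
    refine (hR.2 𝒳 R).unique ⟨fun A => ?_, fun α B => ?_⟩ ⟨fun A => rfl, fun α B => rfl⟩
    · rw [NonUnitalStarAlgHom.comp_apply, hΦP, hΨπ, hσP]
    · rw [NonUnitalStarAlgHom.comp_apply, hΦS, hΨt, hσS]
  have hext := corrRep_ext (ρ := σ.map Φ) (σ := ρ)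
    (fun A => by
      change Φ (σ.π (chi A)) = _
      rw [hσP, hΦP])
    (fun α B => by
      change Φ (σ.t (e α B)) = _
      rw [hσS, hΦS])
  have h2 : Φ.comp Ψ = NonUnitalStarAlgHom.id ℂ 𝒴 := by
    refine (hρ.2.2 𝒴 ρ hρ.1).unique ⟨fun f => ?_, fun x => ?_⟩ ⟨fun f => rfl, fun x => rfl⟩
    · rw [NonUnitalStarAlgHom.comp_apply, hΨπ]
      exact hext.1 f
    · rw [NonUnitalStarAlgHom.comp_apply, hΨt]
      exact hext.2 x
  exact ⟨StarAlgEquiv.ofNonUnitalStarAlgHom Φ Ψ h1 h2, hΦP, hΦS⟩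

end Transfer

/-- Not entirely vacuous: coisometricity includes the existence of `ψ_t`, which holds for every
representation. Hence the Toeplitz case is the relative Cuntz-Pimsner case for the empty set, and
both isomorphisms follow from one argument. -/
theorem isCoisometric_empty {𝒳 : Type*} [NonUnitalCStarAlgebra 𝒳]
    (ρ : D.correspondence.Rep 𝒳) : ρ.IsCoisometric ∅ :=
  let ⟨ψ, hψ⟩ := ρ.exists_compactsMap
  ⟨ψ, hψ, fun _ hf => hf.elim⟩

variable (D) in
theorem relationsMatch_empty : RelationsMatch.{u, v, w} D ∅ ∅ := fun _ _ ρ =>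
  ⟨fun _ _ hA => hA.elim, fun _ => isCoisometric_empty ρ⟩

variable (D) in
theorem relationsMatch_reg : RelationsMatch.{u, v, w} D D.reg D.correspondence.katsuraIdeal :=
  fun _ _ ρ => by
    rw [katsuraIdeal_eq]
    exact isCoisometric_closure_iff ρ

theorem isToeplitzAlgebra_iff {𝒳 : Type w} [NonUnitalCStarAlgebra 𝒳]
    {ρ : D.correspondence.Rep 𝒳} : ρ.IsToeplitzAlgebra ↔ ρ.IsRelCuntzPimsnerAlgebra ∅ :=
  ⟨fun h => ⟨isCoisometric_empty ρ, h.1, fun 𝒴 _ σ _ => h.2 𝒴 σ⟩,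
    fun h => ⟨h.2.1, fun 𝒴 _ σ => h.2.2 𝒴 σ (isCoisometric_empty σ)⟩⟩

end Rep

end GenBoolDynSystem

theorem mainTheorem6 {𝓑 : Type u} {𝓛 : Type v} [GeneralizedBooleanAlgebra 𝓑]
    (D : GenBoolDynSystem 𝓑 𝓛) :
    -- (1) both Toeplitz algebras exist, and they are canonically isomorphic
    ((∃ (𝒯 : Type (max u v w)) (_ : NonUnitalCStarAlgebra 𝒯) (R : D.ToeplitzRep 𝒯),
        R.IsUniversal) ∧
      (∃ (𝒯 : Type (max u v w)) (_ : NonUnitalCStarAlgebra 𝒯) (ρ : D.correspondence.Rep 𝒯),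
        ρ.IsToeplitzAlgebra) ∧
      ∀ (𝒯 𝒯' : Type (max u v w)) [NonUnitalCStarAlgebra 𝒯] [NonUnitalCStarAlgebra 𝒯']
        (R : D.ToeplitzRep 𝒯) (ρ : D.correspondence.Rep 𝒯'),
        R.IsUniversal → ρ.IsToeplitzAlgebra →
        ∃ Φ : 𝒯 ≃⋆ₐ[ℂ] 𝒯', (∀ A, Φ (R.P A) = ρ.π (FunctionAlg.chi A)) ∧
          ∀ α B, Φ (R.S α B) = ρ.t (GenBoolDynSystem.HilbertMod.e α B)) ∧
    -- (2) the `C*`-algebra of the system and the Cuntz-Pimsner algebra exist, and they are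
    -- canonically isomorphic
    ((∃ (𝒪 : Type (max u v w)) (_ : NonUnitalCStarAlgebra 𝒪) (R : D.CuntzKriegerRep 𝒪),
        R.IsUniversal) ∧
      (∃ (𝒪 : Type (max u v w)) (_ : NonUnitalCStarAlgebra 𝒪) (ρ : D.correspondence.Rep 𝒪),
        ρ.IsCuntzPimsnerAlgebra) ∧
      ∀ (𝒪 𝒪' : Type (max u v w)) [NonUnitalCStarAlgebra 𝒪] [NonUnitalCStarAlgebra 𝒪']
        (R : D.CuntzKriegerRep 𝒪) (ρ : D.correspondence.Rep 𝒪'),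
        R.IsUniversal → ρ.IsCuntzPimsnerAlgebra →
        ∃ Φ : 𝒪 ≃⋆ₐ[ℂ] 𝒪', (∀ A, Φ (R.P A) = ρ.π (FunctionAlg.chi A)) ∧
          ∀ α B, Φ (R.S α B) = ρ.t (GenBoolDynSystem.HilbertMod.e α B)) ∧
    -- Katsura's ideal is the closed linear span of the `χ_A` with `A` regular
    D.correspondence.katsuraIdeal =
      closure (Submodule.span ℂ (FunctionAlg.chi '' D.reg) : Set (FunctionAlg 𝓑)) := by

  have hfin : ∀ A ∈ (∅ : Set 𝓑), (D.Δ A).Finite := fun _ hA => hA.elim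
  have hempty := GenBoolDynSystem.Rep.relationsMatch_empty.{u, v, max u v w} D
  have hreg := GenBoolDynSystem.Rep.relationsMatch_reg.{u, v, max u v w} D
  have hT := GenBoolDynSystem.Rep.exists_isUniversal.{u, v, w} hfin
  have hO := GenBoolDynSystem.Rep.exists_isUniversal.{u, v, w} (D := D) (J := D.reg)
    fun A hA => GenBoolDynSystem.finite_Δ_of_mem_reg hA
  refine ⟨⟨hT, ?_, ?_⟩, ⟨hO, ?_, ?_⟩, GenBoolDynSystem.katsuraIdeal_eq⟩
  -- The same algebra serves twice: the universal representation of the system, once extended, is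
  -- universal for the correspondence.
  · obtain ⟨𝒯, inst, R, hR⟩ := hT
    obtain ⟨ρ, hP, hS⟩ := R.exists_corrRep
    exact ⟨𝒯, inst, ρ, GenBoolDynSystem.Rep.isToeplitzAlgebra_iff.2
      (hR.isRelCuntzPimsnerAlgebra hempty hP hS)⟩
  · intro 𝒯 𝒯' _ _ R ρ hR hρ
    exact hR.exists_starAlgEquiv hempty (GenBoolDynSystem.Rep.isToeplitzAlgebra_iff.1 hρ)
  · obtain ⟨𝒪, inst, R, hR⟩ := hO
    obtain ⟨ρ, hP, hS⟩ := R.exists_corrRep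
    exact ⟨𝒪, inst, ρ, hR.isRelCuntzPimsnerAlgebra hreg hP hS⟩
  · intro 𝒪 𝒪' _ _ R ρ hR hρ
    exact hR.exists_starAlgEquiv hreg hρ
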